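/- **Setting.** Let $0\le \underline x<\bar x<\infty$ and $\tau>0$. Let $c_A,c_P\colon[0,1]\to\mathbb R$ be thrice differentiable, strictly increasing and strictly convex, with $c_A(0)=c_P(0)=c_A'(0)=c_P'(0)=0$. Assume $\tau\ge c_A'(1)>c_P(1)$; that $e\mapsto e\,c_A'(e)$ is strictly convex on $[0,1]$; and that for all $e\in[0,1]$ $$\frac{\underline x+\tau}{c_P'(1)}+e>e(1-e)\frac{c_A'''(e)}{c_A''(e)}+1-e .$$ Put $u_A(e)=e\,c_A'(e)-c_A(e)$. **Mechanisms.** A mechanism $m=(e_A,e_P,r_A,r_P,r_\emptyset)$ consists of functions on $[\underline x,\bar x]$ with $e_A(y),e_P(y)\in[0,1]$ and $r_A(y),r_P(y),r_\emptyset(y)\in[0,y+\tau]$. Put $R(y)=e_P(y)r_P(y)+(1-e_P(y))r_\emptyset(y)$. A type $x\in[\underline x,\bar x]$ of an agent privately holds surplus $x$, advances a payment $y\in[0,x]$, exerts an effort $e\in[0,1]$ at cost $c_A(e)$, which yields evidence with probability $e$, and decides whether to disclose evidence. If the agent discloses none, the principal obtains evidence with probability $e_P(y)$ (with probability $1$ if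 $y<\underline x$). If there is evidence and $y<x$, the principal seizes $x$. Otherwise the principal takes $y$ and refunds $r_A(y)$, $r_P(y)$ or $r_\emptyset(y)$ if the agent, the principal or nobody provided evidence, respectively. It is required that $m$ be incentive compatible: for every type $x$ it is optimal to advance $y=x$, exert effort $e_A(x)$ and disclose evidence, where obedience holds with first-order equality, $c_A'(e_A(x))=r_A(x)-R(x)$. The profit function and the loss function of $m$ are $$\Pi_m(x)=x-R(x)-u_A(e_A(x))-c_A(e_A(x))-(1-e_A(x))c_P(e_P(x)),$$ $$\lambda_m(x)=\inf_{y\in[\underline x,x]}\bigl\{e_P(y)x+(1-e_P(y))(y-r_\emptyset(y))\bigr\}.$$ A mechanism $m^*$ is *tighter than* $m$ if $\Pi_m\le\Pi_{m^*}$ and $\lambda_m\le\lambda_{m^*}$ pointwise. A mechanism $m^*$ is *tight* if every mechanism $m$ that is tighter than $m^*$ satisfies $(\Pi_m,\lambda_m)=(\Pi_{m^*},\lambda_{m^*})$. **Type-by-type problem.** For $\lambda\colon[\underline x,\bar x]\to\mathbb R$ and $y\in[\underline x,\bar x]$, let $T(y,\lambda)$ be the set of maximizers of $$y-\bigl(e_Pr_P+(1-e_P)r_\emptyset\bigr)-u_A(e_A)-c_A(e_A)-(1-e_A)c_P(e_P)$$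 over $(e_A,e_P,r_A,r_P,r_\emptyset)\in[0,1]^2\times[0,y+\tau]^3$ subject to $$\lambda(y)\ge y-\bigl(e_Pr_P+(1-e_P)r_\emptyset\bigr)-u_A(e_A),$$ $$\lambda(x)\le e_Px+(1-e_P)(y-r_\emptyset)\quad\text{for all }x\in[y,\bar x],$$ $$c_A'(e_A)=r_A-\bigl(e_Pr_P+(1-e_P)r_\emptyset\bigr).$$ Write $m\in T(\lambda)$ if $m(y)\in T(y,\lambda)$ for all $y\in[\underline x,\bar x]$. Let $\Lambda$ be the set of (weakly) increasing concave $\lambda\colon[\underline x,\bar x]\to\mathbb R$ with $\lambda(\underline x)=\underline x$ and $\lambda(x)\le x$ for all $x$. **Tightening algorithm.** Given a mechanism $m$: 1. let $\lambda^+(x)=\max\{\underline x,\ \sup_{y\in[\underline x,x]}\lambda_m(y)\}$; 2. let $\tilde\lambda(x)=\inf_{y\in[\underline x,\bar x]}\Bigl\{e_P(y)x+\min\bigl\{(1-e_P(y))y,\ \lambda^+(y)+u_A(e_A(y))+e_P(y)\tau\bigr\}\Bigr\}$; 3. choose any $m^*\in T(\tilde\lambda)$. **Theorem.** (i) A tuple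 of functions $m=(e_A,e_P,r_A,r_P,r_\emptyset)$ on $[\underline x,\bar x]$ is a tight mechanism if and only if there is $\lambda\in\Lambda$ with $m\in T(\lambda)$; in this case $\lambda=\lambda_m$ for every such $\lambda$. (ii) For every mechanism $m$ the tightening algorithm can be carried out, i.e. some $m^*\in T(\tilde\lambda)$ exists, and every $m^*$ that it can produce is a tight mechanism and is tighter than $m$. -/

import Mathlib

open Set

/-- The derivative on the unit interval (one-sided at the endpoints). -/
noncomputable def unitDeriv (c : ℝ → ℝ) : ℝ → ℝ :=
  derivWithin c (Icc 0 1)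

/-- The standing assumptions on an effort cost function on `[0, 1]`. -/
structure IsEffortCost (c : ℝ → ℝ) : Prop where
  differentiable_one : DifferentiableOn ℝ c (Icc 0 1)
  differentiable_two : DifferentiableOn ℝ (unitDeriv c) (Icc 0 1)
  differentiable_three : DifferentiableOn ℝ (unitDeriv (unitDeriv c)) (Icc 0 1)
  strictMono : StrictMonoOn c (Icc 0 1)
  strictConvex : StrictConvexOn ℝ (Icc 0 1) c
  zero : c 0 = 0
  deriv_zero : unitDeriv c 0 = 0

/-- The primitives of the model: the type space `[xLow, xHigh]`, the principal's funds `tau`, and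
the effort costs of the agent and of the principal. -/
structure Environment where
  xLow : ℝ
  xHigh : ℝ
  tau : ℝ
  costA : ℝ → ℝ
  costP : ℝ → ℝ

/-- What a tax mechanism specifies for one advance payment: the recommended effort `eA` of the
agent, the effort `eP` of the principal, and the refunds `rA`, `rP`, `rN` that are paid if the
agent, the principal, or nobody provides evidence. -/
structure Contract where
  eA : ℝ
  eP : ℝ
  rA : ℝ
  rP : ℝ
  rN : ℝ

/-- The expected refund if the agent provides no evidence. -/
def Contract.refundNA (k : Contract) : ℝ :=
  k.eP * k.rP + (1 - k.eP) * k.rN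

namespace Environment

variable (S : Environment)

/-- The type space. -/
def types : Set ℝ := Icc S.xLow S.xHigh

/-- The standing assumptions of the model. -/
structure Standing : Prop where
  low_nonneg : 0 ≤ S.xLow
  low_lt_high : S.xLow < S.xHigh
  tau_pos : 0 < S.tau
  isEffortCost_costA : IsEffortCost S.costA
  isEffortCost_costP : IsEffortCost S.costP
  budget : unitDeriv S.costA 1 ≤ S.tau
  costP_lt : S.costP 1 < unitDeriv S.costA 1
  regularity : ∀ e ∈ Icc (0 : ℝ) 1,
    e * (1 - e) * (unitDeriv (unitDeriv (unitDeriv S.costA)) e / unitDeriv (unitDeriv S.costA) e)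
        + (1 - e)
      < (S.xLow + S.tau) / unitDeriv S.costP 1 + e
  rent_regularity : StrictConvexOn ℝ (Icc 0 1) (fun e => e * unitDeriv S.costA e)

/-- The evidence rent `u_A`. -/
noncomputable def rent (e : ℝ) : ℝ :=
  e * unitDeriv S.costA e - S.costA e

/-- Efforts are probabilities and refunds lie in `[0, y + tau]`. -/
def FeasibleAt (y : ℝ) (k : Contract) : Prop :=
  k.eA ∈ Icc (0 : ℝ) 1 ∧ k.eP ∈ Icc (0 : ℝ) 1 ∧
    k.rA ∈ Icc 0 (y + S.tau) ∧ k.rP ∈ Icc 0 (y + S.tau) ∧ k.rN ∈ Icc 0 (y + S.tau)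

/-- The agent finds the recommended effort optimal by the first-order condition. -/
def ObedientAt (k : Contract) : Prop :=
  unitDeriv S.costA k.eA = k.rA - k.refundNA

/-- The principal's profit from a truthful type `y`. -/
noncomputable def profitAt (y : ℝ) (k : Contract) : ℝ :=
  y - k.refundNA - S.rent k.eA - S.costA k.eA - (1 - k.eA) * S.costP k.eP

/-- The probability that the principal audits after the advance payment `y` and no evidence from
the agent; payments below the lowest type are audited for sure. -/
noncomputable def auditProb (m : ℝ → Contract) (y : ℝ) : ℝ :=
  if y < S.xLow then 1 else (m y).eP

open Classical in
/-- The probability of presenting evidence when exerting effort `e` and planning to disclose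
evidence or not. -/
noncomputable def presentProb (e : ℝ) (disclose : Prop) : ℝ :=
  if disclose then e else 0

/-- The expected payoff of type `x` who advances `y ≤ x`, exerts effort `e`, and discloses evidence
or not. After `y = x` the agent keeps the refund. After `y < x` the full surplus is seized if
there is evidence from either side, and otherwise the agent keeps `x - y` plus the refund. -/
noncomputable def agentPayoff (m : ℝ → Contract) (x y e : ℝ) (disclose : Prop) : ℝ :=
  if y = x then
    presentProb e disclose * (m x).rA + (1 - presentProb e disclose) * (m x).refundNA - S.costA e
  else
    (1 - presentProb e disclose) * ((1 - S.auditProb m y) * (x - (y - (m y).rN))) - S.costA e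

/-- Every type finds it optimal to advance the full surplus, to exert the recommended effort, and
to disclose evidence. -/
def IncentiveCompatible (m : ℝ → Contract) : Prop :=
  ∀ x ∈ S.types, ∀ y ∈ Icc 0 x, ∀ e ∈ Icc (0 : ℝ) 1, ∀ disclose : Prop,
    S.agentPayoff m x y e disclose ≤ S.agentPayoff m x x (m x).eA True

/-- A mechanism: a feasible and incentive compatible tax mechanism. The agent's obedience holds
with first-order equality, so that the truthful agent's evidence rent is `u_A`. Only the
values of `m` on the type space matter. -/
structure IsMechanism (m : ℝ → Contract) : Prop where
  feasible : ∀ y ∈ S.types, S.FeasibleAt y (m y)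
  obedient : ∀ y ∈ S.types, S.ObedientAt (m y)
  incentiveCompatible : S.IncentiveCompatible m

/-- The profit function `Π_m`. -/
noncomputable def profit (m : ℝ → Contract) (x : ℝ) : ℝ :=
  S.profitAt x (m x)

/-- The loss function `λ_m`. -/
noncomputable def loss (m : ℝ → Contract) (x : ℝ) : ℝ :=
  sInf ((fun y => (m y).eP * x + (1 - (m y).eP) * (y - (m y).rN)) '' Icc S.xLow x)

/-- `mStar` is tighter than `m`. -/
def Tighter (mStar m : ℝ → Contract) : Prop :=
  ∀ x ∈ S.types, S.profit m x ≤ S.profit mStar x ∧ S.loss m x ≤ S.loss mStar x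

/-- A mechanism is tight if every mechanism that is tighter has the same profit and loss. -/
def IsTight (m : ℝ → Contract) : Prop :=
  S.IsMechanism m ∧ ∀ m' : ℝ → Contract, S.IsMechanism m' → S.Tighter m' m →
    EqOn (S.profit m) (S.profit m') S.types ∧ EqOn (S.loss m) (S.loss m') S.types

/-- The constraint set `M(y, λ)`. -/
def constraintSet (lam : ℝ → ℝ) (y : ℝ) : Set Contract :=
  {k | S.FeasibleAt y k ∧
    y - k.refundNA - S.rent k.eA ≤ lam y ∧
    (∀ x ∈ Icc y S.xHigh, lam x ≤ k.eP * x + (1 - k.eP) * (y - k.rN)) ∧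
    S.ObedientAt k}

/-- The set of maximizers `T(y, λ)`. -/
def solutionSet (lam : ℝ → ℝ) (y : ℝ) : Set Contract :=
  {k | k ∈ S.constraintSet lam y ∧ ∀ k' ∈ S.constraintSet lam y, S.profitAt y k' ≤ S.profitAt y k}

/-- `m ∈ T(λ)`: the mechanism solves the maximization problem type by type. -/
def Solves (lam : ℝ → ℝ) (m : ℝ → Contract) : Prop :=
  ∀ y ∈ S.types, m y ∈ S.solutionSet lam y

/-- The class `Λ` of increasing concave functions `λ` on the type space with `λ(xLow) = xLow` and
`λ ≤ id`. -/
structure IsRegularLoss (lam : ℝ → ℝ) : Prop where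
  monotone : MonotoneOn lam S.types
  concave : ConcaveOn ℝ S.types lam
  low : lam S.xLow = S.xLow
  le_id : ∀ x ∈ S.types, lam x ≤ x

/-- Step 1 of the tightening algorithm: `λ⁺`. -/
noncomputable def lossPlus (m : ℝ → Contract) (x : ℝ) : ℝ :=
  max S.xLow (sSup (S.loss m '' Icc S.xLow x))

/-- Step 2 of the tightening algorithm: the regularized loss function. -/
noncomputable def lossTilde (m : ℝ → Contract) (x : ℝ) : ℝ :=
  sInf ((fun y => (m y).eP * x +
      min ((1 - (m y).eP) * y) (S.lossPlus m y + S.rent (m y).eA + (m y).eP * S.tau)) '' S.types)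

/-- Step 3: `mStar` is a possible output of the tightening algorithm with input `m`. -/
def IsTighteningOutput (m mStar : ℝ → Contract) : Prop :=
  S.Solves (S.lossTilde m) mStar

end Environment

/-! Incentive compatibility amounts to `x - R(x) - u_A ≤ λ_m(x)`: the best deviation is an
underpayment without effort. Hence for λ in Λ every solution of the type-by-type problem is a
mechanism whose loss is at least λ.

For fixed efforts `(a, p)` the refunds can be eliminated: the least expected refund `max 0 (y - λ(y)
- u_A(a))` is best, paid as far as possible after evidence from the principal. What remains is a
minimization over efforts (`AuditFeasible`, `auditCost`). Its minimizer exists by compactness and is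
unique by a midpoint argument (`AuditFeasible.exists_midpoint`); the latter is where the two
regularity assumptions enter.

The core is `CostLE.eqOn`: if λ ≤ λ' in Λ and λ' permits costs no higher than λ at every payment,
then λ = λ'. Let z be the infimum of the types where they differ, and take a supergradient line of λ
at x₀ just above z. If λ(z) < z, the optimal efforts at payments up to z are the same under both
functions. The audit probability is continuous between z and the last earlier y with λ(y) = y, so at
some payment it equals the slope of that line. Its binding constraint forces λ'(x₀) ≤ λ(x₀). If λ(z)
= z, the line itself comes from a payment just above z with zero refund, and any pair as cheap under
λ' cannot audit more.

The regularized loss λ̃ of a mechanism lies in Λ, dominates its loss, and keeps its efforts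
feasible, so solutions for λ̃ are tighter. If a mechanism m' is tighter than a solution for λ, then
λ ≤ λ_{m'} ≤ λ̃_{m'}, and the core result collapses the chain; this gives tightness and λ = λ_m.
Conversely, a tight mechanism has the profit and loss of any output of the algorithm, so it solves
the problem for its own λ̃. -/

/-! ### Effort costs -/

theorem unitDeriv_hasDerivWithinAt {c : ℝ → ℝ} (hc : DifferentiableOn ℝ c (Icc 0 1)) {t : ℝ}
    (ht : t ∈ Icc (0 : ℝ) 1) : HasDerivWithinAt c (unitDeriv c t) (Icc 0 1) t :=
  (hc t ht).hasDerivWithinAt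

namespace IsEffortCost

variable {c : ℝ → ℝ}

theorem continuousOn (hc : IsEffortCost c) : ContinuousOn c (Icc 0 1) :=
  hc.differentiable_one.continuousOn

theorem continuousOn_unitDeriv (hc : IsEffortCost c) : ContinuousOn (unitDeriv c) (Icc 0 1) :=
  hc.differentiable_two.continuousOn

theorem strictMonoOn_unitDeriv (hc : IsEffortCost c) : StrictMonoOn (unitDeriv c) (Icc 0 1) :=
  hc.strictConvex.strictMonoOn_derivWithin hc.differentiable_one

theorem nonneg (hc : IsEffortCost c) {t : ℝ} (ht : t ∈ Icc (0 : ℝ) 1) : 0 ≤ c t := by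
  rw [← hc.zero]
  exact hc.strictMono.monotoneOn (left_mem_Icc.2 zero_le_one) ht ht.1

theorem unitDeriv_nonneg (hc : IsEffortCost c) {t : ℝ} (ht : t ∈ Icc (0 : ℝ) 1) :
    0 ≤ unitDeriv c t := by
  rw [← hc.deriv_zero]
  exact hc.strictMonoOn_unitDeriv.monotoneOn (left_mem_Icc.2 zero_le_one) ht ht.1

theorem unitDeriv_pos (hc : IsEffortCost c) {t : ℝ} (ht : t ∈ Icc (0 : ℝ) 1) (h0 : 0 < t) :
    0 < unitDeriv c t := by
  rw [← hc.deriv_zero]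
  exact hc.strictMonoOn_unitDeriv (left_mem_Icc.2 zero_le_one) ht h0

theorem pos (hc : IsEffortCost c) {t : ℝ} (ht : t ∈ Icc (0 : ℝ) 1) (h0 : 0 < t) : 0 < c t := by
  rw [← hc.zero]
  exact hc.strictMono (left_mem_Icc.2 zero_le_one) ht h0

theorem unitDeriv_two_nonneg (hc : IsEffortCost c) (t : ℝ) : 0 ≤ unitDeriv (unitDeriv c) t :=
  hc.strictMonoOn_unitDeriv.monotoneOn.derivWithin_nonneg

/-- A convex cost lies above its tangents. -/
theorem tangent_le (hc : IsEffortCost c) {p q : ℝ} (hp : p ∈ Icc (0 : ℝ) 1)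
    (hq : q ∈ Icc (0 : ℝ) 1) : c p + unitDeriv c p * (q - p) ≤ c q := by
  have hd := unitDeriv_hasDerivWithinAt hc.differentiable_one hp
  rcases lt_trichotomy p q with h | h | h
  · have := hc.strictConvex.convexOn.le_slope_of_hasDerivWithinAt hp hq h hd
    rw [slope_def_field, le_div_iff₀ (by linarith)] at this
    linarith
  · simp [h]
  · have := hc.strictConvex.convexOn.slope_le_of_hasDerivWithinAt hq hp h hd
    rw [slope_def_field, div_le_iff₀ (by linarith)] at this
    linarith

theorem tangent_lt (hc : IsEffortCost c) {p q : ℝ} (hp : p ∈ Icc (0 : ℝ) 1)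
    (hq : q ∈ Icc (0 : ℝ) 1) (hpq : p ≠ q) : c p + unitDeriv c p * (q - p) < c q := by
  have hd := unitDeriv_hasDerivWithinAt hc.differentiable_one hp
  rcases lt_or_gt_of_ne hpq with h | h
  · have := hc.strictConvex.lt_slope_of_hasDerivWithinAt hp hq h hd
    rw [slope_def_field, lt_div_iff₀ (by linarith)] at this
    linarith
  · have := hc.strictConvex.slope_lt_of_hasDerivWithinAt hq hp h hd
    rw [slope_def_field, div_lt_iff₀ (by linarith)] at this
    linarith

/-- The third derivative vanishes where the second does, inside the unit interval. -/
theorem mul_unitDeriv_three_eq_zero (hc : IsEffortCost c) {t : ℝ} (ht : t ∈ Icc (0 : ℝ) 1)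
    (h : unitDeriv (unitDeriv c) t = 0) :
    t * (1 - t) * unitDeriv (unitDeriv (unitDeriv c)) t = 0 := by
  rcases ht.1.eq_or_lt with h0 | h0
  · simp [← h0]
  rcases ht.2.eq_or_lt with h1 | h1
  · simp [h1]
  -- The second derivative is nonnegative, so an interior zero is a minimum; the endpoints were
  -- removed by the factor `t * (1 - t)`.
  have hmin : IsLocalMin (unitDeriv (unitDeriv c)) t :=
    Filter.Eventually.of_forall fun x => by rw [h]; exact hc.unitDeriv_two_nonneg x
  have hd := (unitDeriv_hasDerivWithinAt hc.differentiable_three ht).hasDerivAt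
    (Icc_mem_nhds h0 h1)
  rw [hmin.hasDerivAt_eq_zero hd, mul_zero]

end IsEffortCost

/-! ### The evidence rent and its curvature -/

namespace Environment

variable {S : Environment}

namespace Standing

theorem low_add_tau_pos (hS : S.Standing) : 0 < S.xLow + S.tau :=
  add_pos_of_nonneg_of_pos hS.low_nonneg hS.tau_pos

theorem rent_nonneg (hS : S.Standing) {t : ℝ} (ht : t ∈ Icc (0 : ℝ) 1) : 0 ≤ S.rent t := by
  have := hS.isEffortCost_costA.tangent_le ht (left_mem_Icc.2 zero_le_one)
  rw [hS.isEffortCost_costA.zero] at this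
  unfold rent
  linarith

theorem rent_zero (hS : S.Standing) : S.rent 0 = 0 := by
  simp [rent, hS.isEffortCost_costA.zero]

theorem hasDerivWithinAt_rent (hS : S.Standing) {t : ℝ} (ht : t ∈ Icc (0 : ℝ) 1) :
    HasDerivWithinAt S.rent (t * unitDeriv (unitDeriv S.costA) t) (Icc 0 1) t := by
  have hA := hS.isEffortCost_costA
  have h1 := unitDeriv_hasDerivWithinAt hA.differentiable_one ht
  have h2 := unitDeriv_hasDerivWithinAt hA.differentiable_two ht
  have := ((hasDerivWithinAt_id t (Icc 0 1)).mul h2).sub h1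
  refine this.congr_deriv ?_
  simp

theorem continuousOn_rent (hS : S.Standing) : ContinuousOn S.rent (Icc 0 1) :=
  fun _ ht => (hS.hasDerivWithinAt_rent ht).continuousWithinAt

theorem rent_strictMonoOn (hS : S.Standing) : StrictMonoOn S.rent (Icc 0 1) := by
  intro s hs t ht hst
  have hA := hS.isEffortCost_costA
  have h1 := hA.tangent_lt ht hs hst.ne'
  have h2 := mul_le_mul_of_nonneg_left (hA.strictMonoOn_unitDeriv hs ht hst).le hs.1
  unfold rent
  linarith

/-- The second-order consequence of the regularity assumption. -/
theorem curvature_bound (hS : S.Standing) {t : ℝ} (ht : t ∈ Icc (0 : ℝ) 1) {g : ℝ} (hg : 0 ≤ g)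
    (hg' : g * (S.xLow + S.tau) ≤ unitDeriv S.costP 1) :
    g * ((1 - 2 * t) * unitDeriv (unitDeriv S.costA) t
      + t * (1 - t) * unitDeriv (unitDeriv (unitDeriv S.costA)) t)
      ≤ unitDeriv (unitDeriv S.costA) t := by
  have hA := hS.isEffortCost_costA
  have h2 := hA.unitDeriv_two_nonneg t
  have hreg := hS.regularity t ht
  have hP : 0 < unitDeriv S.costP 1 :=
    hS.isEffortCost_costP.unitDeriv_pos (right_mem_Icc.2 zero_le_one) one_pos
  have h3 := hA.mul_unitDeriv_three_eq_zero ht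
  have hlow := hS.low_add_tau_pos
  set c2 := unitDeriv (unitDeriv S.costA) t
  set c3 := unitDeriv (unitDeriv (unitDeriv S.costA)) t
  -- Where the second derivative vanishes, the quotient in the regularity assumption is zero by
  -- convention and carries no information; there the third-order term vanishes as well.
  rcases h2.eq_or_lt with h0 | h0
  · rw [h3 h0.symm, ← h0]
    simp
  have key : (1 - 2 * t) * c2 + t * (1 - t) * c3
      ≤ (S.xLow + S.tau) / unitDeriv S.costP 1 * c2 := by
    have := mul_le_mul_of_nonneg_right hreg.le h0.le
    have e : t * (1 - t) * (c3 / c2) * c2 = t * (1 - t) * c3 := by field_simp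
    nlinarith
  have hgG : g * ((S.xLow + S.tau) / unitDeriv S.costP 1) ≤ 1 := by
    rw [← mul_div_assoc]
    exact (div_le_one hP).2 hg'
  calc g * ((1 - 2 * t) * c2 + t * (1 - t) * c3)
      ≤ g * ((S.xLow + S.tau) / unitDeriv S.costP 1 * c2) := mul_le_mul_of_nonneg_left key hg
    _ = g * ((S.xLow + S.tau) / unitDeriv S.costP 1) * c2 := by ring
    _ ≤ 1 * c2 := mul_le_mul_of_nonneg_right hgG h0.le
    _ = c2 := one_mul _

/-- Convexity of the effort cost net of the audit savings that come with a higher rent. -/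
theorem strictConvexOn_cost_sub_rent (hS : S.Standing) {g : ℝ} (hg : 0 < g)
    (hg' : g * (S.xLow + S.tau) ≤ unitDeriv S.costP 1) :
    StrictConvexOn ℝ (Icc 0 1) fun t => S.costA t - g * ((1 - t) * S.rent t) := by
  have hA := hS.isEffortCost_costA
  -- The derivative of the target function is this term, nondecreasing by `curvature_bound`, plus `g
  -- * rent`, which is strictly increasing.
  have hmono : MonotoneOn (fun t => unitDeriv S.costA t
      - g * ((t - t ^ 2) * unitDeriv (unitDeriv S.costA) t)) (Icc 0 1) := by
    have hd : ∀ t ∈ Icc (0 : ℝ) 1, HasDerivWithinAt (fun t => unitDeriv S.costA t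
        - g * ((t - t ^ 2) * unitDeriv (unitDeriv S.costA) t))
        (unitDeriv (unitDeriv S.costA) t - g * ((1 - 2 * t) * unitDeriv (unitDeriv S.costA) t
          + (t - t ^ 2) * unitDeriv (unitDeriv (unitDeriv S.costA)) t)) (Icc 0 1) t := by
      intro t ht
      have h2 := unitDeriv_hasDerivWithinAt hA.differentiable_two ht
      have h3 := unitDeriv_hasDerivWithinAt hA.differentiable_three ht
      have hq : HasDerivWithinAt (fun t : ℝ => t - t ^ 2) (1 - 2 * t) (Icc 0 1) t :=
        ((hasDerivAt_id t).sub (hasDerivAt_pow 2 t)).hasDerivWithinAt.congr_deriv (by simp)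
      exact h2.sub ((hq.mul h3).const_mul g)
    refine monotoneOn_of_hasDerivWithinAt_nonneg (convex_Icc 0 1)
      (fun t ht => (hd t ht).continuousWithinAt)
      (fun t ht => (hd t (interior_subset ht)).mono interior_subset) ?_
    intro t ht
    have := hS.curvature_bound (interior_subset ht) hg.le hg'
    have e : t - t ^ 2 = t * (1 - t) := by ring
    rw [e]
    linarith
  have hd : ∀ t ∈ Icc (0 : ℝ) 1, HasDerivWithinAt
      (fun t => S.costA t - g * ((1 - t) * S.rent t))
      ((unitDeriv S.costA t - g * ((t - t ^ 2) * unitDeriv (unitDeriv S.costA) t))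
        + g * S.rent t) (Icc 0 1) t := by
    intro t ht
    have h1 := unitDeriv_hasDerivWithinAt hA.differentiable_one ht
    have hq : HasDerivWithinAt (fun t : ℝ => 1 - t) (-1) (Icc 0 1) t :=
      ((hasDerivAt_id t).const_sub 1).hasDerivWithinAt
    refine (h1.sub ((hq.mul (hS.hasDerivWithinAt_rent ht)).const_mul g)).congr_deriv ?_
    ring
  refine StrictMonoOn.strictConvexOn_of_deriv (convex_Icc 0 1)
    (fun t ht => (hd t ht).continuousWithinAt) ?_
  rw [interior_Icc]
  have hder : ∀ t ∈ Ioo (0 : ℝ) 1, deriv (fun t => S.costA t - g * ((1 - t) * S.rent t)) t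
      = (unitDeriv S.costA t - g * ((t - t ^ 2) * unitDeriv (unitDeriv S.costA) t))
        + g * S.rent t := fun t ht =>
    ((hd t (Ioo_subset_Icc_self ht)).hasDerivAt (Icc_mem_nhds ht.1 ht.2)).deriv
  intro s hs t ht hst
  rw [hder s hs, hder t ht]
  have h1 := hmono (Ioo_subset_Icc_self hs) (Ioo_subset_Icc_self ht) hst.le
  have h2 := mul_lt_mul_of_pos_left
    (hS.rent_strictMonoOn (Ioo_subset_Icc_self hs) (Ioo_subset_Icc_self ht) hst) hg
  simp only at h1
  linarith

end Standing

end Environment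

/-! ### Regular loss functions -/

namespace Environment

variable {S : Environment}

namespace IsRegularLoss

variable {lam : ℝ → ℝ}

theorem low_le (h : S.IsRegularLoss lam) {x : ℝ} (hx : x ∈ S.types) : S.xLow ≤ lam x := by
  rw [← h.low]
  exact h.monotone ⟨le_rfl, hx.1.trans hx.2⟩ hx hx.1

/-- Three-chord inequality. -/
theorem chord (h : S.IsRegularLoss lam) {x y z : ℝ} (hx : x ∈ S.types) (hz : z ∈ S.types)
    (hxy : x ≤ y) (hyz : y ≤ z) :
    (z - y) * lam x + (y - x) * lam z ≤ (z - x) * lam y := by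
  rcases (hxy.trans hyz).eq_or_lt with e | hxz
  · obtain rfl : x = y := le_antisymm hxy (e ▸ hyz)
    rw [e]
    simp
  have hpos : 0 < z - x := by linarith
  have := h.concave.2 hx hz (div_nonneg (by linarith : 0 ≤ z - y) hpos.le)
    (div_nonneg (by linarith : 0 ≤ y - x) hpos.le) (by field_simp; ring)
  have e : (z - y) / (z - x) * x + (y - x) / (z - x) * z = y := by field_simp; ring
  simp only [smul_eq_mul, e] at this
  have h2 := mul_le_mul_of_nonneg_left this hpos.le
  have e2 : (z - x) * ((z - y) / (z - x) * lam x + (y - x) / (z - x) * lam z)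
    = (z - y) * lam x + (y - x) * lam z := by field_simp
  linarith

/-- The average slope from `xLow` up to `x` is at most one because `lam` starts on the diagonal and
stays below it; concavity carries this bound to the right of `x`. -/
theorem le_add_sub (h : S.IsRegularLoss lam) {x y : ℝ} (hx : x ∈ S.types) (hy : y ∈ S.types)
    (hxy : x ≤ y) : lam y ≤ lam x + (y - x) := by
  have hlow : S.xLow ∈ S.types := ⟨le_rfl, hx.1.trans hx.2⟩
  rcases hx.1.eq_or_lt with e | hlt
  · rw [← e, h.low]
    linarith [h.le_id y hy]
  have := h.chord hlow hy hx.1 hxy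
  rw [h.low] at this
  have h2 := mul_le_mul_of_nonneg_left (h.le_id x hx) (by linarith : 0 ≤ y - x)
  have h3 : (x - S.xLow) * lam y ≤ (x - S.xLow) * (lam x + (y - x)) := by nlinarith
  exact le_of_mul_le_mul_left h3 (by linarith)

theorem continuousOn (h : S.IsRegularLoss lam) : ContinuousOn lam S.types := by
  refine (LipschitzOnWith.of_le_add_mul 1 fun x hx y hy => ?_ :
    LipschitzOnWith 1 lam S.types).continuousOn
  rw [Real.dist_eq, NNReal.coe_one, one_mul]
  rcases le_total x y with hxy | hxy
  · exact (h.monotone hx hy hxy).trans (le_add_of_nonneg_right (abs_nonneg _))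
  · rw [abs_of_nonneg (sub_nonneg.2 hxy)]
    exact h.le_add_sub hy hx hxy

/-- A supergradient at an interior type. -/
theorem exists_supergradient (h : S.IsRegularLoss lam) {x₀ : ℝ} (h1 : S.xLow < x₀)
    (h2 : x₀ < S.xHigh) : ∃ s, ∀ x ∈ S.types, lam x ≤ lam x₀ + s * (x - x₀) := by
  have hx₀ : x₀ ∈ S.types := ⟨h1.le, h2.le⟩
  have hlow : S.xLow ∈ S.types := ⟨le_rfl, (h1.trans h2).le⟩
  have hcross : ∀ u ∈ S.types, u < x₀ → ∀ v ∈ S.types, x₀ < v →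
      (lam v - lam x₀) / (v - x₀) ≤ (lam x₀ - lam u) / (x₀ - u) := by
    intro u hu hux v hv hxv
    rw [div_le_div_iff₀ (by linarith) (by linarith)]
    linarith [h.chord hu hv hux.le hxv.le]
  -- The supergradient is the supremum of the right difference quotients, each bounded by every left
  -- quotient.
  set A := (fun v => (lam v - lam x₀) / (v - x₀)) '' Ioc x₀ S.xHigh
  have hne : A.Nonempty := ⟨_, mem_image_of_mem _ (right_mem_Ioc.2 h2)⟩
  have hub : ∀ u ∈ S.types, u < x₀ → (lam x₀ - lam u) / (x₀ - u) ∈ upperBounds A := by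
    rintro u hu hux _ ⟨v, hv, rfl⟩
    exact hcross u hu hux v ⟨h1.le.trans hv.1.le, hv.2⟩ hv.1
  refine ⟨sSup A, fun x hx => ?_⟩
  rcases lt_trichotomy x x₀ with hlt | rfl | hgt
  · have := csSup_le hne (hub x hx hlt)
    rw [le_div_iff₀ (by linarith)] at this
    linarith
  · simp
  · have := le_csSup ⟨_, hub _ hlow h1⟩ (mem_image_of_mem _ ⟨hgt, hx.2⟩ :
      (lam x - lam x₀) / (x - x₀) ∈ A)
    rw [div_le_iff₀ (by linarith)] at this
    linarith

end IsRegularLoss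

/-! ### Elimination of the refunds -/

variable (S) in
/-- The efforts `(a, p)` of the agent and the principal that satisfy the constraints of the
type-by-type problem for some refunds. -/
structure AuditFeasible (lam : ℝ → ℝ) (y a p : ℝ) : Prop where
  agent : a ∈ Icc (0 : ℝ) 1
  audit : p ∈ Icc (0 : ℝ) 1
  seize : ∀ x ∈ Icc y S.xHigh, lam x ≤ p * x + (1 - p) * y
  refund : ∀ x ∈ Icc y S.xHigh, lam x ≤ p * (x + S.tau) + lam y + S.rent a

variable (S) in
/-- The negative of the best profit that is compatible with the efforts `(a, p)`. -/
noncomputable def auditCost (lam : ℝ → ℝ) (y a p : ℝ) : ℝ :=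
  S.rent a + S.costA a + (1 - a) * S.costP p - min y (lam y + S.rent a)

variable (S) in
/-- The efforts `(a, p)` minimize `auditCost`. -/
structure AuditOptimal (lam : ℝ → ℝ) (y a p : ℝ) : Prop extends S.AuditFeasible lam y a p where
  le : ∀ a' p', S.AuditFeasible lam y a' p' → S.auditCost lam y a p ≤ S.auditCost lam y a' p'

variable {lam : ℝ → ℝ} {y a p : ℝ}

/-- In this form both branches of the maximum are strictly convex in the agent's effort. The first
applies when a positive refund is needed, the second when none is. -/
theorem auditCost_eq : S.auditCost lam y a p =
    max (S.costA a) (a * unitDeriv S.costA a - (y - lam y)) - lam y + (1 - a) * S.costP p := by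
  unfold auditCost rent
  rcases le_total y (lam y + (a * unitDeriv S.costA a - S.costA a)) with h | h
  · rw [min_eq_left h, max_eq_right (by linarith)]
    ring
  · rw [min_eq_right h, max_eq_left (by linarith)]
    ring

/-- The bound `rN ≥ 0` yields `seize`. The bound `rP ≤ y + tau`, combined with the ceiling `lam y`
on what the principal takes net of the rent, yields `refund`. -/
theorem AuditFeasible.of_mem_constraintSet {k : Contract}
    (hk : k ∈ S.constraintSet lam y) : S.AuditFeasible lam y k.eA k.eP := by
  obtain ⟨⟨ha, hp, -, hrP, hrN⟩, hl, hx, -⟩ := hk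
  refine ⟨ha, hp, fun x hxy => ?_, fun x hxy => ?_⟩
  · have := mul_nonneg (sub_nonneg.2 hp.2) hrN.1
    linarith [hx x hxy]
  · have := mul_le_mul_of_nonneg_left hrP.2 hp.1
    have := hx x hxy
    unfold Contract.refundNA at hl
    linarith

theorem profitAt_le_of_mem_constraintSet {k : Contract} (hk : k ∈ S.constraintSet lam y) :
    S.profitAt y k ≤ - S.auditCost lam y k.eA k.eP := by
  obtain ⟨⟨-, hp, -, hrP, hrN⟩, hl, -, -⟩ := hk
  have h0 : 0 ≤ k.refundNA :=
    add_nonneg (mul_nonneg hp.1 hrP.1) (mul_nonneg (sub_nonneg.2 hp.2) hrN.1)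
  have : y - k.refundNA ≤ min y (lam y + S.rent k.eA) := le_min (by linarith) (by linarith)
  unfold profitAt auditCost
  linarith

/-- Any feasible pair of efforts is completed to a contract by the least refunds, with `rN` as
small as possible. -/
theorem AuditFeasible.exists_contract (hS : S.Standing) (hlam : S.IsRegularLoss lam)
    (hy : y ∈ S.types) (h : S.AuditFeasible lam y a p) :
    ∃ k ∈ S.constraintSet lam y, S.profitAt y k = - S.auditCost lam y a p := by
  have hA := hS.isEffortCost_costA
  have hy0 : 0 ≤ y := hS.low_nonneg.trans hy.1
  have hl0 : 0 ≤ lam y := hS.low_nonneg.trans (hlam.low_le hy)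
  have hτ := hS.tau_pos
  have hu := hS.rent_nonneg h.agent
  -- The least expected refund that respects nonnegativity and the ceiling `lam y`.
  set R := max 0 (y - lam y - S.rent a) with hR
  have hR0 : 0 ≤ R := le_max_left _ _
  have hRy : R ≤ y := max_le hy0 (by linarith)
  have hRl : y - R - S.rent a ≤ lam y := by linarith [le_max_right 0 (y - lam y - S.rent a)]
  have hmin : y - R = min y (lam y + S.rent a) := by
    rcases le_total 0 (y - lam y - S.rent a) with h' | h'
    · rw [hR, max_eq_right h', min_eq_right (by linarith)]
      ring
    · rw [hR, max_eq_left h', min_eq_left (by linarith)]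
      ring
  have hrA : R + unitDeriv S.costA a ∈ Icc 0 (y + S.tau) :=
    ⟨add_nonneg hR0 (hA.unitDeriv_nonneg h.agent), add_le_add hRy
      ((hA.strictMonoOn_unitDeriv.monotoneOn h.agent (right_mem_Icc.2 zero_le_one)
        h.agent.2).trans hS.budget)⟩
  obtain ⟨rP, rN, hrP, hrN, hpR, hloss⟩ : ∃ rP rN : ℝ, rP ∈ Icc 0 (y + S.tau) ∧
      rN ∈ Icc 0 (y + S.tau) ∧ p * rP + (1 - p) * rN = R ∧
      ∀ x ∈ Icc y S.xHigh, lam x ≤ p * x + (1 - p) * (y - rN) := by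
    -- If `rP` alone can carry `R`, then `rN = 0` and the loss constraint is `seize`. Otherwise `rP`
    -- is at its cap, `rN` pays the remainder, and the loss constraint becomes `refund`.
    rcases le_or_gt R (p * (y + S.tau)) with hle | hlt
    · rcases h.audit.1.eq_or_lt with h0 | h0
      · refine ⟨0, 0, ⟨le_rfl, by linarith⟩, ⟨le_rfl, by linarith⟩, ?_, fun x hx => ?_⟩
        · rw [← h0] at hle
          linarith
        · rw [sub_zero]
          exact h.seize x hx
      · refine ⟨R / p, 0, ⟨div_nonneg hR0 h0.le, ?_⟩, ⟨le_rfl, by linarith⟩, ?_, fun x hx => ?_⟩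
        · rw [div_le_iff₀ h0]
          linarith
        · field_simp
          ring
        · rw [sub_zero]
          exact h.seize x hx
    · have hp1 : p < 1 := by
        rcases h.audit.2.eq_or_lt with h1 | h1
        · rw [h1] at hlt
          linarith
        · exact h1
      have hq : 0 < 1 - p := by linarith
      have hmul : (1 - p) * ((R - p * (y + S.tau)) / (1 - p)) = R - p * (y + S.tau) := by
        field_simp
      refine ⟨y + S.tau, (R - p * (y + S.tau)) / (1 - p), ⟨by linarith, le_rfl⟩,
        ⟨div_nonneg (by linarith) hq.le, ?_⟩, ?_, fun x hx => ?_⟩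
      · rw [div_le_iff₀ hq]
        linarith
      · rw [hmul]
        ring
      · have hRpos : 0 < R :=
          (mul_nonneg h.audit.1 (by linarith : 0 ≤ y + S.tau)).trans_lt hlt
        have hR' : R = y - lam y - S.rent a := by
          rcases le_total 0 (y - lam y - S.rent a) with h' | h'
          · rw [hR, max_eq_right h']
          · rw [hR, max_eq_left h'] at hRpos
            exact absurd hRpos (lt_irrefl 0)
        rw [mul_sub, hmul]
        linarith [h.refund x hx]
  have hkR : (⟨a, p, R + unitDeriv S.costA a, rP, rN⟩ : Contract).refundNA = R := hpR
  refine ⟨⟨a, p, R + unitDeriv S.costA a, rP, rN⟩,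
    ⟨⟨h.agent, h.audit, hrA, hrP, hrN⟩, ?_, hloss, ?_⟩, ?_⟩
  · rw [hkR]
    exact hRl
  · unfold ObedientAt
    rw [hkR]
    ring
  · unfold profitAt auditCost
    rw [hkR, ← hmin]
    ring

theorem AuditFeasible.full (hS : S.Standing) (hlam : S.IsRegularLoss lam) (hy : y ∈ S.types)
    (ha : a ∈ Icc (0 : ℝ) 1) : S.AuditFeasible lam y a 1 := by
  have := hS.rent_nonneg ha
  have := hS.low_nonneg.trans (hlam.low_le hy)
  refine ⟨ha, right_mem_Icc.2 zero_le_one, fun x hx => ?_, fun x hx => ?_⟩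
  · linarith [hlam.le_id x ⟨hy.1.trans hx.1, hx.2⟩]
  · linarith [hlam.le_id x ⟨hy.1.trans hx.1, hx.2⟩, hS.tau_pos]

theorem continuousOn_auditCost (hS : S.Standing) (hlam : S.IsRegularLoss lam) :
    ContinuousOn (fun q : ℝ × ℝ × ℝ => S.auditCost lam q.1 q.2.1 q.2.2)
      (S.types ×ˢ Icc 0 1 ×ˢ Icc 0 1) := by
  have h1 : ContinuousOn (fun q : ℝ × ℝ × ℝ => S.rent q.2.1) (S.types ×ˢ Icc 0 1 ×ˢ Icc 0 1) :=
    hS.continuousOn_rent.comp (by fun_prop) fun q hq => hq.2.1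
  have h2 : ContinuousOn (fun q : ℝ × ℝ × ℝ => S.costA q.2.1)
      (S.types ×ˢ Icc 0 1 ×ˢ Icc 0 1) :=
    hS.isEffortCost_costA.continuousOn.comp (by fun_prop) fun q hq => hq.2.1
  have h3 : ContinuousOn (fun q : ℝ × ℝ × ℝ => S.costP q.2.2)
      (S.types ×ˢ Icc 0 1 ×ˢ Icc 0 1) :=
    hS.isEffortCost_costP.continuousOn.comp (by fun_prop) fun q hq => hq.2.2
  have h4 : ContinuousOn (fun q : ℝ × ℝ × ℝ => lam q.1) (S.types ×ˢ Icc 0 1 ×ˢ Icc 0 1) :=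
    hlam.continuousOn.comp (by fun_prop) fun q hq => hq.1
  unfold auditCost
  have h5 : ContinuousOn (fun q : ℝ × ℝ × ℝ => 1 - q.2.1) (S.types ×ˢ Icc 0 1 ×ˢ Icc 0 1) := by
    fun_prop
  have h6 : ContinuousOn (fun q : ℝ × ℝ × ℝ => q.1) (S.types ×ˢ Icc 0 1 ×ˢ Icc 0 1) := by
    fun_prop
  exact ((h1.add h2).add (h5.mul h3)).sub fun q hq => (h6 q hq).min ((h4.add h1) q hq)

/-- The feasible efforts have a closed graph. -/
theorem AuditFeasible.of_tendsto (hS : S.Standing) (hlam : S.IsRegularLoss lam)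
    {ys as ps : ℕ → ℝ} (hys : ∀ n, ys n ∈ S.types) (h : ∀ n, S.AuditFeasible lam (ys n) (as n) (ps n))
    (hy : Filter.Tendsto ys Filter.atTop (nhds y)) (ha : Filter.Tendsto as Filter.atTop (nhds a))
    (hp : Filter.Tendsto ps Filter.atTop (nhds p)) : S.AuditFeasible lam y a p := by
  have hyT : y ∈ S.types := isClosed_Icc.mem_of_tendsto hy (.of_forall hys)
  have haI : a ∈ Icc (0 : ℝ) 1 := isClosed_Icc.mem_of_tendsto ha (.of_forall fun n => (h n).agent)
  have hpI : p ∈ Icc (0 : ℝ) 1 := isClosed_Icc.mem_of_tendsto hp (.of_forall fun n => (h n).audit)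
  have hlamy : Filter.Tendsto (fun n => lam (ys n)) Filter.atTop (nhds (lam y)) :=
    (hlam.continuousOn y hyT).tendsto.comp
      (tendsto_nhdsWithin_iff.2 ⟨hy, .of_forall hys⟩)
  have hu : Filter.Tendsto (fun n => S.rent (as n)) Filter.atTop (nhds (S.rent a)) :=
    (hS.continuousOn_rent a haI).tendsto.comp
      (tendsto_nhdsWithin_iff.2 ⟨ha, .of_forall fun n => (h n).agent⟩)
  -- `max x (ys n)` is an admissible type for the contract at `ys n`
  have key : ∀ x ∈ Icc y S.xHigh, Filter.Tendsto (fun n => max x (ys n)) Filter.atTop (nhds x) ∧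
      Filter.Tendsto (fun n => lam (max x (ys n))) Filter.atTop (nhds (lam x)) := by
    intro x hx
    have hxT : x ∈ S.types := ⟨hyT.1.trans hx.1, hx.2⟩
    have h1 : Filter.Tendsto (fun n => max x (ys n)) Filter.atTop (nhds x) := by
      have := (tendsto_const_nhds (x := x)).max hy
      rwa [max_eq_left hx.1] at this
    refine ⟨h1, (hlam.continuousOn x hxT).tendsto.comp (tendsto_nhdsWithin_iff.2 ⟨h1,
      .of_forall fun n => ⟨hxT.1.trans (le_max_left _ _), max_le hx.2 (hys n).2⟩⟩)⟩
  refine ⟨haI, hpI, fun x hx => ?_, fun x hx => ?_⟩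
  · obtain ⟨h1, h2⟩ := key x hx
    refine le_of_tendsto_of_tendsto' h2 ((hp.mul h1).add ((hp.const_sub 1).mul hy)) fun n => ?_
    exact (h n).seize _ ⟨le_max_right _ _, max_le hx.2 (hys n).2⟩
  · obtain ⟨h1, h2⟩ := key x hx
    refine le_of_tendsto_of_tendsto' h2 (((hp.mul (h1.add_const S.tau)).add hlamy).add hu)
      fun n => ?_
    exact (h n).refund _ ⟨le_max_right _ _, max_le hx.2 (hys n).2⟩

theorem isCompact_auditFeasible (hS : S.Standing) (hlam : S.IsRegularLoss lam)
    (hy : y ∈ S.types) : IsCompact {q : ℝ × ℝ | S.AuditFeasible lam y q.1 q.2} := by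
  refine (isCompact_Icc.prod isCompact_Icc : IsCompact (Icc (0 : ℝ) 1 ×ˢ Icc (0 : ℝ) 1)).of_isClosed_subset
    (isSeqClosed_iff_isClosed.1 ?_) fun q hq => ⟨hq.agent, hq.audit⟩
  intro qs q hqs hq
  exact AuditFeasible.of_tendsto hS hlam (fun _ => hy) hqs tendsto_const_nhds
    ((continuous_fst.tendsto q).comp hq) ((continuous_snd.tendsto q).comp hq)

theorem exists_auditOptimal (hS : S.Standing) (hlam : S.IsRegularLoss lam) (hy : y ∈ S.types) :
    ∃ a p, S.AuditOptimal lam y a p := by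
  have hcont : ContinuousOn (fun q : ℝ × ℝ => S.auditCost lam y q.1 q.2)
      {q : ℝ × ℝ | S.AuditFeasible lam y q.1 q.2} :=
    (continuousOn_auditCost hS hlam).comp (f := fun q : ℝ × ℝ => (y, q)) (by fun_prop)
      fun q hq => ⟨hy, hq.agent, hq.audit⟩
  obtain ⟨q, hq, hmin⟩ := (isCompact_auditFeasible hS hlam hy).exists_isMinOn
    ⟨(0, 1), AuditFeasible.full hS hlam hy (left_mem_Icc.2 zero_le_one)⟩ hcont
  exact ⟨q.1, q.2, hq, fun a' p' h' => hmin (a := (a', p')) h'⟩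

/-- The type-by-type problem has a solution. -/
theorem solutionSet_nonempty (hS : S.Standing) (hlam : S.IsRegularLoss lam) (hy : y ∈ S.types) :
    (S.solutionSet lam y).Nonempty := by
  obtain ⟨a, p, h⟩ := exists_auditOptimal hS hlam hy
  obtain ⟨k, hk, e⟩ := h.exists_contract hS hlam hy
  refine ⟨k, hk, fun k' hk' => ?_⟩
  have := h.le _ _ (AuditFeasible.of_mem_constraintSet hk')
  linarith [profitAt_le_of_mem_constraintSet hk']

/-- A solution earns at least what any feasible pair of efforts earns. -/
theorem neg_auditCost_le_profitAt (hS : S.Standing) (hlam : S.IsRegularLoss lam)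
    (hy : y ∈ S.types) {k : Contract} (hk : k ∈ S.solutionSet lam y)
    (h : S.AuditFeasible lam y a p) : - S.auditCost lam y a p ≤ S.profitAt y k := by
  obtain ⟨k', hk', e⟩ := h.exists_contract hS hlam hy
  rw [← e]
  exact hk.2 k' hk'

end Environment

/-! ### Uniqueness and continuity of the optimal efforts -/

theorem IsEffortCost.exists_unitDeriv_eq {c : ℝ → ℝ} (hc : IsEffortCost c) {v : ℝ} (h0 : 0 ≤ v)
    (h1 : v ≤ unitDeriv c 1) : ∃ t ∈ Icc (0 : ℝ) 1, unitDeriv c t = v :=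
  intermediate_value_Icc zero_le_one hc.continuousOn_unitDeriv ⟨hc.deriv_zero.trans_le h0, h1⟩

theorem StrictConvexOn.midpoint_lt {s : Set ℝ} {f : ℝ → ℝ} (hf : StrictConvexOn ℝ s f) {a b : ℝ}
    (ha : a ∈ s) (hb : b ∈ s) (hab : a ≠ b) : f ((a + b) / 2) < (f a + f b) / 2 := by
  have := hf.2 ha hb hab (by norm_num : (0 : ℝ) < 1 / 2) (by norm_num : (0 : ℝ) < 1 / 2)
    (by norm_num)
  have e : (1 / 2 : ℝ) * a + 1 / 2 * b = (a + b) / 2 := by ring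
  simp only [smul_eq_mul, e] at this
  linarith

namespace Environment

variable {S : Environment} {lam : ℝ → ℝ} {y a p : ℝ}

/-- The agent's effort is below one, since full effort is more costly than an audit. -/
theorem AuditOptimal.agent_lt_one (hS : S.Standing) (hlam : S.IsRegularLoss lam)
    (hy : y ∈ S.types) (h : S.AuditOptimal lam y a p) : a < 1 := by
  refine lt_of_le_of_ne h.agent.2 ?_
  rintro rfl
  have hA := hS.isEffortCost_costA
  have hone : (1 : ℝ) ∈ Icc (0 : ℝ) 1 := right_mem_Icc.2 zero_le_one
  have hP0 := hS.isEffortCost_costP.nonneg hone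
  have hlt := hS.costP_lt
  -- At an effort `t` whose marginal cost lies strictly between `costP 1` and the marginal cost at
  -- one, even a sure audit is cheaper: both branches of the maximum fall by more than the audit
  -- costs.
  obtain ⟨t, ht, e⟩ := hA.exists_unitDeriv_eq
    (v := (S.costP 1 + unitDeriv S.costA 1) / 2) (by linarith) (by linarith)
  have ht1 : t < 1 := lt_of_le_of_ne ht.2 (by rintro rfl; linarith)
  have htan := hA.tangent_le ht hone
  have hmul := mul_lt_mul_of_pos_right (show S.costP 1 < unitDeriv S.costA t by linarith)
    (sub_pos.2 ht1)
  have hmul2 := mul_lt_mul_of_pos_right hlt (sub_pos.2 ht1)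
  have hmul3 := mul_le_mul_of_nonneg_left (show unitDeriv S.costA t ≤ unitDeriv S.costA 1 by
    linarith) ht.1
  have hle := h.le t 1 (AuditFeasible.full hS hlam hy ht)
  rw [auditCost_eq, auditCost_eq] at hle
  have : max (S.costA t) (t * unitDeriv S.costA t - (y - lam y)) + (1 - t) * S.costP 1
      < max (S.costA 1) (1 * unitDeriv S.costA 1 - (y - lam y)) := by
    rw [← max_add_add_right]
    exact max_lt_max (by linarith) (by linarith)
  linarith

theorem AuditFeasible.mono (h : S.AuditFeasible lam y a p) (hS : S.Standing) (hy : S.xLow ≤ y)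
    {q : ℝ} (hpq : p ≤ q) (hq : q ≤ 1) : S.AuditFeasible lam y a q := by
  refine ⟨h.agent, ⟨h.audit.1.trans hpq, hq⟩, fun x hx => ?_, fun x hx => ?_⟩
  · have := mul_le_mul_of_nonneg_right hpq (sub_nonneg.2 hx.1)
    linarith [h.seize x hx]
  · have := mul_le_mul_of_nonneg_right hpq
      (by linarith [hS.low_add_tau_pos, hx.1] : 0 ≤ x + S.tau)
    linarith [h.refund x hx]

/-- Averaging the agent's effort strictly lowers the average cost, for a suitable audit. -/
theorem AuditFeasible.exists_midpoint (hS : S.Standing) (hlam : S.IsRegularLoss lam)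
    (hy : y ∈ S.types) {a₁ a₂ p₁ p₂ : ℝ} (h₁ : S.AuditFeasible lam y a₁ p₁)
    (h₂ : S.AuditFeasible lam y a₂ p₂) (hne : a₁ ≠ a₂) :
    ∃ p, S.AuditFeasible lam y ((a₁ + a₂) / 2) p ∧
      S.auditCost lam y ((a₁ + a₂) / 2) p
        < (S.auditCost lam y a₁ p₁ + S.auditCost lam y a₂ p₂) / 2 := by
  have hA := hS.isEffortCost_costA
  have hP := hS.isEffortCost_costP
  have hτ := hS.tau_pos
  have hlow := hS.low_nonneg
  have ha₁ := h₁.agent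
  have ha₂ := h₂.agent
  have hp₁ := h₁.audit
  have hp₂ := h₂.audit
  have ha : (a₁ + a₂) / 2 ∈ Icc (0 : ℝ) 1 :=
    ⟨by linarith [ha₁.1, ha₂.1], by linarith [ha₁.2, ha₂.2]⟩
  have hcA := hA.strictConvex.midpoint_lt ha₁ ha₂ hne
  simp only [auditCost_eq]
  have hm₁ := le_max_left (S.costA a₁) (a₁ * unitDeriv S.costA a₁ - (y - lam y))
  have hm₂ := le_max_left (S.costA a₂) (a₂ * unitDeriv S.costA a₂ - (y - lam y))
  -- `seize` does not involve the agent's effort, so it survives for the smaller audit. If `refund`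
  -- holds too, strict convexity of both branches suffices.
  set q := min p₁ p₂ with hq
  have hqI : q ∈ Icc (0 : ℝ) 1 := ⟨le_min hp₁.1 hp₂.1, (min_le_left _ _).trans hp₁.2⟩
  have hseize : ∀ x ∈ Icc y S.xHigh, lam x ≤ q * x + (1 - q) * y := by
    intro x hx
    rcases min_choice p₁ p₂ with e | e
    · rw [hq, e]
      exact h₁.seize x hx
    · rw [hq, e]
      exact h₂.seize x hx
  by_cases hfeas : S.AuditFeasible lam y ((a₁ + a₂) / 2) q
  · refine ⟨q, hfeas, ?_⟩
    have hr := hS.rent_regularity.midpoint_lt ha₁ ha₂ hne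
    have hn₁ := le_max_right (S.costA a₁) (a₁ * unitDeriv S.costA a₁ - (y - lam y))
    have hn₂ := le_max_right (S.costA a₂) (a₂ * unitDeriv S.costA a₂ - (y - lam y))
    have hmax : max (S.costA ((a₁ + a₂) / 2))
        ((a₁ + a₂) / 2 * unitDeriv S.costA ((a₁ + a₂) / 2) - (y - lam y))
        < (max (S.costA a₁) (a₁ * unitDeriv S.costA a₁ - (y - lam y))
          + max (S.costA a₂) (a₂ * unitDeriv S.costA a₂ - (y - lam y))) / 2 :=
      max_lt (by linarith) (by linarith)
    have e₁ := mul_le_mul_of_nonneg_left (hP.strictMono.monotoneOn hqI hp₁ (min_le_left _ _))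
      (sub_nonneg.2 ha₁.2)
    have e₂ := mul_le_mul_of_nonneg_left (hP.strictMono.monotoneOn hqI hp₂ (min_le_right _ _))
      (sub_nonneg.2 ha₂.2)
    linarith
  -- the least audit probability that satisfies the second constraint
  set u := S.rent ((a₁ + a₂) / 2)
  have hpos : ∀ x ∈ Icc y S.xHigh, 0 < x + S.tau := fun x hx => by linarith [hy.1, hx.1]
  have hsub : Icc y S.xHigh ⊆ S.types := fun x hx => ⟨hy.1.trans hx.1, hx.2⟩
  obtain ⟨x, hx, hmax⟩ := isCompact_Icc.exists_isMaxOn (nonempty_Icc.2 hy.2)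
    (f := fun x => (lam x - lam y - u) / (x + S.tau))
    ((((hlam.continuousOn.mono hsub).sub continuousOn_const).sub continuousOn_const).div
      (continuousOn_id.add continuousOn_const) fun x hx => (hpos x hx).ne')
  set p := (lam x - lam y - u) / (x + S.tau) with hp
  have hpx : p * (x + S.tau) = lam x - lam y - u := div_mul_cancel₀ _ (hpos x hx).ne'
  have hrefund : ∀ x' ∈ Icc y S.xHigh, lam x' ≤ p * (x' + S.tau) + lam y + u := by
    intro x' hx'
    have := (div_le_iff₀ (hpos x' hx')).1 (hmax hx')
    linarith
  have hqp : q < p := by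
    by_contra! hle
    refine hfeas ⟨ha, hqI, hseize, fun x' hx' => ?_⟩
    have := mul_le_mul_of_nonneg_right hle (hpos x' hx').le
    linarith [hrefund x' hx']
  have hp0 : 0 < p := hqI.1.trans_lt hqp
  have hp1 : p ≤ 1 := by
    rw [hp, div_le_one (hpos x hx)]
    have := hS.rent_nonneg ha
    linarith [hlam.le_id x (hsub hx), hlam.low_le hy]
  have hseize' : ∀ x ∈ Icc y S.xHigh, lam x ≤ p * x + (1 - p) * y := by
    intro x' hx'
    have := mul_le_mul_of_nonneg_right hqp.le (sub_nonneg.2 hx'.1)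
    linarith [hseize x' hx']
  refine ⟨p, ⟨ha, ⟨hp0.le, hp1⟩, hseize', hrefund⟩, ?_⟩
  -- A positive audit forced by `refund`, while `seize` holds, means that a refund is paid at the
  -- midpoint, so the maximum there is plain `costA`.
  have hslack : u < y - lam y := by
    have := mul_pos hp0 (hpos y ⟨le_rfl, hy.2⟩)
    linarith [hseize' x hx]
  have hmaxeq : max (S.costA ((a₁ + a₂) / 2))
      ((a₁ + a₂) / 2 * unitDeriv S.costA ((a₁ + a₂) / 2) - (y - lam y))
      = S.costA ((a₁ + a₂) / 2) := by
    refine max_eq_left ?_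
    have : u = (a₁ + a₂) / 2 * unitDeriv S.costA ((a₁ + a₂) / 2) - S.costA ((a₁ + a₂) / 2) := rfl
    linarith
  rw [hmaxeq]
  have hpI : p ∈ Icc (0 : ℝ) 1 := ⟨hp0.le, hp1⟩
  have hκ : 0 < unitDeriv S.costP p := hP.unitDeriv_pos hpI hp0
  -- The marginal audit saving per unit of rent: at the binding type `x`, one more unit of rent
  -- lowers the required audit by `1 / (x + tau)`.
  set g := unitDeriv S.costP p / (x + S.tau) with hg
  have hg0 : 0 < g := div_pos hκ (hpos x hx)
  have hgx : g * (x + S.tau) = unitDeriv S.costP p := div_mul_cancel₀ _ (hpos x hx).ne'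
  have hgle : g * (S.xLow + S.tau) ≤ unitDeriv S.costP 1 := by
    have h1 := mul_le_mul_of_nonneg_left
      (show S.xLow + S.tau ≤ x + S.tau by linarith [(hsub hx).1]) hg0.le
    have h2 := hP.strictMonoOn_unitDeriv.monotoneOn hpI (right_mem_Icc.2 zero_le_one) hp1
    linarith
  have hconv := (hS.strictConvexOn_cost_sub_rent hg0 hgle).midpoint_lt ha₁ ha₂ hne
  -- The tangent of `costP` at `p` bounds audit costs below by a function affine in the rent, with
  -- equality at the midpoint. The comparison thus reduces to `strictConvexOn_cost_sub_rent`.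
  have hline : ∀ b r, S.AuditFeasible lam y b r →
      (1 - b) * (S.costP p + g * (u - S.rent b)) ≤ (1 - b) * S.costP r := by
    intro b r hbr
    refine mul_le_mul_of_nonneg_left ?_ (sub_nonneg.2 hbr.agent.2)
    have h1 := hP.tangent_le hpI hbr.audit
    have h2 : u - S.rent b ≤ (r - p) * (x + S.tau) := by linarith [hbr.refund x hx]
    have h3 := mul_le_mul_of_nonneg_left h2 hg0.le
    have h4 : g * ((r - p) * (x + S.tau)) = unitDeriv S.costP p * (r - p) := by
      rw [← hgx]
      ring
    linarith
  have e₁ := hline _ _ h₁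
  have e₂ := hline _ _ h₂
  change S.costA ((a₁ + a₂) / 2) - g * ((1 - (a₁ + a₂) / 2) * u) < _ at hconv
  linarith

/-- Different agent efforts would be beaten by their midpoint. With a common effort below one, the
audit cost has positive weight and pins down the audit. -/
theorem AuditOptimal.unique (hS : S.Standing) (hlam : S.IsRegularLoss lam) (hy : y ∈ S.types)
    {a₁ a₂ p₁ p₂ : ℝ} (h₁ : S.AuditOptimal lam y a₁ p₁) (h₂ : S.AuditOptimal lam y a₂ p₂) :
    a₁ = a₂ ∧ p₁ = p₂ := by
  have hle := h₁.le _ _ h₂.toAuditFeasible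
  have hge := h₂.le _ _ h₁.toAuditFeasible
  have ha : a₁ = a₂ := by
    by_contra hne
    obtain ⟨p, hp, hlt⟩ := h₁.toAuditFeasible.exists_midpoint hS hlam hy h₂.toAuditFeasible hne
    linarith [h₁.le _ _ hp]
  subst ha
  refine ⟨rfl, hS.isEffortCost_costP.strictMono.injOn h₁.audit h₂.audit ?_⟩
  have h1 := h₁.agent_lt_one hS hlam hy
  unfold auditCost at hle hge
  exact mul_left_cancel₀ (sub_pos.2 h1).ne' (le_antisymm (by linarith) (by linarith))

/-- An optimal audit with positive probability makes some type indifferent. -/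
theorem AuditOptimal.exists_binding (hS : S.Standing) (hlam : S.IsRegularLoss lam)
    (hy : y ∈ S.types) (h : S.AuditOptimal lam y a p) (hp : 0 < p) :
    ∃ x ∈ Icc y S.xHigh, lam x = p * x + (1 - p) * y ∨
      lam x = p * (x + S.tau) + lam y + S.rent a := by
  by_contra! hcon
  have hsub : Icc y S.xHigh ⊆ S.types := fun x hx => ⟨hy.1.trans hx.1, hx.2⟩
  have hc := hlam.continuousOn.mono hsub
  have hl1 : ContinuousOn (fun x => p * x + (1 - p) * y - lam x) (Icc y S.xHigh) :=
    ContinuousOn.sub (by fun_prop) hc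
  have hl2 : ContinuousOn (fun x => p * (x + S.tau) + lam y + S.rent a - lam x) (Icc y S.xHigh) :=
    ContinuousOn.sub (by fun_prop) hc
  obtain ⟨x₀, hx₀, hmin⟩ := isCompact_Icc.exists_isMinOn (nonempty_Icc.2 hy.2)
    (f := fun x => min (p * x + (1 - p) * y - lam x)
      (p * (x + S.tau) + lam y + S.rent a - lam x)) (fun x hx => (hl1 x hx).min (hl2 x hx))
  set ε := min (p * x₀ + (1 - p) * y - lam x₀) (p * (x₀ + S.tau) + lam y + S.rent a - lam x₀)
  have hε : 0 < ε := lt_min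
    (sub_pos.2 (lt_of_le_of_ne (h.seize x₀ hx₀) (hcon x₀ hx₀).1))
    (sub_pos.2 (lt_of_le_of_ne (h.refund x₀ hx₀) (hcon x₀ hx₀).2))
  have hbound : ∀ x ∈ Icc y S.xHigh, ε ≤ p * x + (1 - p) * y - lam x ∧
      ε ≤ p * (x + S.tau) + lam y + S.rent a - lam x := fun x hx => le_min_iff.1 (hmin hx)
  have hM : 0 < S.xHigh + S.tau := by linarith [hS.low_add_tau_pos, hy.1, hy.2]
  set δ := min p (ε / (S.xHigh + S.tau))
  have hδ : 0 < δ := lt_min hp (div_pos hε hM)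
  have hδM : δ * (S.xHigh + S.tau) ≤ ε := (le_div_iff₀ hM).1 (min_le_right _ _)
  have hδp : δ ≤ p := min_le_left _ _
  have hδx : ∀ x ∈ Icc y S.xHigh, δ * (x + S.tau) ≤ ε := fun x hx =>
    (mul_le_mul_of_nonneg_left (by linarith [hx.2]) hδ.le).trans hδM
  have hp' : p - δ ∈ Icc (0 : ℝ) 1 := ⟨by linarith, by linarith [h.audit.2]⟩
  have hfeas : S.AuditFeasible lam y a (p - δ) := by
    refine ⟨h.agent, hp', fun x hx => ?_, fun x hx => ?_⟩
    · have := mul_nonneg hδ.le (by linarith [hS.low_add_tau_pos, hy.1] : 0 ≤ y + S.tau)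
      linarith [(hbound x hx).1, hδx x hx]
    · linarith [(hbound x hx).2, hδx x hx]
  have hle := h.le _ _ hfeas
  have hlt := mul_lt_mul_of_pos_left
    (hS.isEffortCost_costP.strictMono hp' h.audit (by linarith : p - δ < p))
    (sub_pos.2 (h.agent_lt_one hS hlam hy))
  unfold auditCost at hle
  linarith

/-- Away from types whose loss is the full surplus, the least cost is upper semicontinuous. -/
theorem AuditFeasible.eventually_exists (hS : S.Standing) (hlam : S.IsRegularLoss lam) {D : Set ℝ}
    (hD : D ⊆ S.types) (hy : y ∈ D) (hleft : ∀ y' ∈ D, y' < y → lam y < y)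
    (h : S.AuditFeasible lam y a p) {v : ℝ} (hv : S.auditCost lam y a p < v) :
    ∀ᶠ y' in nhdsWithin y D, ∃ a' p', S.AuditFeasible lam y' a' p' ∧
      S.auditCost lam y' a' p' < v := by
  have hτ := hS.tau_pos
  have hyT := hD hy
  have hp := h.audit
  have hcost := continuousOn_auditCost hS hlam
  -- Raising the audit by a small `ε` keeps the cost below `v` and creates the slack that absorbs
  -- the change of payment.
  obtain ⟨ε, hεv, hε⟩ : ∃ ε, S.auditCost lam y a (min 1 (p + ε)) < v ∧ 0 < ε := by
    have hc : ContinuousOn (fun ε : ℝ => S.auditCost lam y a (min 1 (p + ε))) (Ici 0) := by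
      refine hcost.comp (f := fun ε : ℝ => (y, a, min 1 (p + ε))) (by fun_prop) fun ε hε => ?_
      exact ⟨hyT, h.agent, le_min zero_le_one (add_nonneg hp.1 hε), min_le_left _ _⟩
    have h0 : S.auditCost lam y a (min 1 (p + 0)) < v := by rwa [add_zero, min_eq_right hp.2]
    have hev := (hc 0 self_mem_Ici).eventually (gt_mem_nhds h0)
    exact ((hev.filter_mono (nhdsWithin_mono _ Ioi_subset_Ici_self)).and
      self_mem_nhdsWithin).exists
  set q := min 1 (p + ε) with hq
  have hqI : q ∈ Icc (0 : ℝ) 1 := ⟨le_min zero_le_one (by linarith [hp.1]), min_le_left _ _⟩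
  have hpq : p ≤ q := le_min hp.2 (by linarith)
  have hcostq : ∀ᶠ y' in nhdsWithin y D, S.auditCost lam y' a q < v := by
    have hc : ContinuousOn (fun y' : ℝ => S.auditCost lam y' a q) D :=
      hcost.comp (f := fun y' : ℝ => (y', a, q)) (by fun_prop) fun y' hy' =>
        ⟨hD hy', h.agent, hqI⟩
    exact (hc y hy).eventually (gt_mem_nhds hεv)
  obtain ⟨r, hr, hrτ, hrd, hrε⟩ : ∃ r > 0, r ≤ ε * S.tau ∧
      (lam y < y → r ≤ (y - lam y) / 2) ∧ (lam y < y → r ≤ ε * ((y - lam y) / 2)) := by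
    by_cases hly : lam y < y
    · have hd : 0 < (y - lam y) / 2 := by linarith
      refine ⟨min (ε * S.tau) (min ((y - lam y) / 2) (ε * ((y - lam y) / 2))),
        lt_min (mul_pos hε hτ) (lt_min hd (mul_pos hε hd)), min_le_left _ _, fun _ => ?_,
        fun _ => ?_⟩
      · exact (min_le_right _ _).trans (min_le_left _ _)
      · exact (min_le_right _ _).trans (min_le_right _ _)
    · exact ⟨ε * S.tau, mul_pos hε hτ, le_rfl, fun h' => absurd h' hly, fun h' => absurd h' hly⟩
  have hnear : ∀ᶠ y' in nhdsWithin y D, y - r < y' :=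
    (eventually_gt_nhds (by linarith : y - r < y)).filter_mono nhdsWithin_le_nhds
  filter_upwards [hcostq, hnear, self_mem_nhdsWithin] with y' hc' hr' hy'
  have hyT' := hD hy'
  refine ⟨a, q, ?_, hc'⟩
  rcases le_or_gt y y' with hle | hlt
  · have hfq := h.mono hS hyT.1 hpq hqI.2
    refine ⟨h.agent, hqI, fun x hx => ?_, fun x hx => ?_⟩
    · have := mul_le_mul_of_nonneg_left hle (sub_nonneg.2 hqI.2)
      linarith [hfq.seize x ⟨hle.trans hx.1, hx.2⟩]
    · linarith [hfq.refund x ⟨hle.trans hx.1, hx.2⟩, hlam.monotone hyT hyT' hle]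
  rcases le_total 1 (p + ε) with h1 | h1
  · rw [hq, min_eq_left h1]
    exact AuditFeasible.full hS hlam hyT' h.agent
  have hqe : q = p + ε := min_eq_right h1
  have hly := hleft y' hy' hlt
  have hrd' := hrd hly
  have hrε' := hrε hly
  have hlip := hlam.le_add_sub hyT' hyT hlt.le
  have hu := hS.rent_nonneg h.agent
  have hy0 : 0 ≤ y' := hS.low_nonneg.trans hyT'.1
  refine ⟨h.agent, hqI, fun x hx => ?_, fun x hx => ?_⟩
  · have hxT : x ∈ S.types := ⟨hyT'.1.trans hx.1, hx.2⟩
    -- For a payment left of `y`, the gap `y - lam y` gives `lam x ≤ y'` at nearby types; at distant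
    -- types the extra audit `ε` makes up for the lower payment.
    rcases le_or_gt x (y + (y - lam y) / 2) with hxl | hxg
    · have h2 : lam x ≤ y' := by
        rcases le_total x y with hxy | hxy
        · linarith [hlam.monotone hxT hyT hxy]
        · linarith [hlam.le_add_sub hyT hxT hxy]
      linarith [mul_nonneg hqI.1 (sub_nonneg.2 hx.1)]
    · have h2 := h.seize x ⟨by linarith, hx.2⟩
      have h3 := mul_le_mul_of_nonneg_left
        (show (y - lam y) / 2 ≤ x - y' by linarith) hε.le
      have h4 := mul_nonneg hp.1 (sub_nonneg.2 hlt.le)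
      rw [hqe]
      linarith
  · have hxT : x ∈ S.types := ⟨hyT'.1.trans hx.1, hx.2⟩
    have hεx := mul_nonneg hε.le (hy0.trans hx.1)
    rcases le_total y x with hxy | hxy
    · have h2 := h.refund x ⟨hxy, hx.2⟩
      rw [hqe]
      linarith
    · have h2 := hlam.monotone hxT hyT hxy
      have h3 := mul_nonneg hp.1 (by linarith [hx.1] : 0 ≤ x + S.tau)
      rw [hqe]
      linarith

/-- Optimal efforts have a closed graph, away from types whose loss is the full surplus. -/
theorem AuditOptimal.of_tendsto (hS : S.Standing) (hlam : S.IsRegularLoss lam) {D : Set ℝ}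
    (hD : D ⊆ S.types) (hy : y ∈ D) (hleft : ∀ y' ∈ D, y' < y → lam y < y)
    {ys as ps : ℕ → ℝ} (hys : ∀ n, ys n ∈ D) (h : ∀ n, S.AuditOptimal lam (ys n) (as n) (ps n))
    (hyt : Filter.Tendsto ys Filter.atTop (nhds y)) (ha : Filter.Tendsto as Filter.atTop (nhds a))
    (hp : Filter.Tendsto ps Filter.atTop (nhds p)) : S.AuditOptimal lam y a p := by
  have hfeas : S.AuditFeasible lam y a p := AuditFeasible.of_tendsto hS hlam
    (fun n => hD (hys n)) (fun n => (h n).toAuditFeasible) hyt ha hp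
  have hcost : Filter.Tendsto (fun n => S.auditCost lam (ys n) (as n) (ps n))
      Filter.atTop (nhds (S.auditCost lam y a p)) := by
    have haw := tendsto_nhdsWithin_iff.2 ⟨ha, .of_forall fun n => (h n).agent⟩
    have hpw := tendsto_nhdsWithin_iff.2 ⟨hp, .of_forall fun n => (h n).audit⟩
    have hyw := tendsto_nhdsWithin_iff.2 ⟨hyt, .of_forall fun n => hD (hys n)⟩
    have h1 := (hS.continuousOn_rent a hfeas.agent).tendsto.comp haw
    have h2 := (hS.isEffortCost_costA.continuousOn a hfeas.agent).tendsto.comp haw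
    have h3 := (hS.isEffortCost_costP.continuousOn p hfeas.audit).tendsto.comp hpw
    have h4 := (hlam.continuousOn y (hD hy)).tendsto.comp hyw
    exact ((h1.add h2).add ((ha.const_sub 1).mul h3)).sub (hyt.min (h4.add h1))
  refine ⟨hfeas, fun a₁ p₁ h₁ => le_of_forall_gt_imp_ge_of_dense fun v hv => ?_⟩
  have hev := (tendsto_nhdsWithin_iff.2 ⟨hyt, .of_forall hys⟩).eventually
    (h₁.eventually_exists hS hlam hD hy hleft hv)
  refine le_of_tendsto hcost (hev.mono fun n hn => ?_)
  obtain ⟨a₂, p₂, h₂, hlt⟩ := hn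
  exact ((h n).le _ _ h₂).trans hlt.le

/-- The optimal audit probability depends continuously on the payment. -/
theorem continuousOn_audit (hS : S.Standing) (hlam : S.IsRegularLoss lam) {D : Set ℝ}
    (hD : D ⊆ S.types) (hleft : ∀ y ∈ D, ∀ y' ∈ D, y' < y → lam y < y) {f g : ℝ → ℝ}
    (hfg : ∀ y ∈ D, S.AuditOptimal lam y (f y) (g y)) : ContinuousOn g D := by
  intro y hy
  -- By compactness the efforts converge along a subsequence; the limit is optimal by the closed
  -- graph, hence equal to the optimum by uniqueness.
  refine Filter.tendsto_of_subseq_tendsto fun ns hns => ?_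
  obtain ⟨hnsy, hnsD⟩ := tendsto_nhdsWithin_iff.1 hns
  obtain ⟨N, hN⟩ := Filter.eventually_atTop.1 hnsD
  obtain ⟨⟨a', p'⟩, -, ms, hms, hlim⟩ :=
    (isCompact_Icc.prod isCompact_Icc : IsCompact (Icc (0 : ℝ) 1 ×ˢ Icc (0 : ℝ) 1)).tendsto_subseq
      (x := fun n => (f (ns (n + N)), g (ns (n + N))))
      fun n => ⟨(hfg _ (hN _ (Nat.le_add_left N n))).agent,
        (hfg _ (hN _ (Nat.le_add_left N n))).audit⟩
  have hD' : ∀ n, ns (ms n + N) ∈ D := fun n => hN _ (Nat.le_add_left N _)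
  have hlp : Filter.Tendsto (fun n => g (ns (ms n + N))) Filter.atTop (nhds p') :=
    (continuous_snd.tendsto _).comp hlim
  have hopt : S.AuditOptimal lam y a' p' :=
    AuditOptimal.of_tendsto hS hlam hD hy (hleft y hy) hD' (fun n => hfg _ (hD' n))
      ((hnsy.comp (Filter.tendsto_add_atTop_nat N)).comp hms.tendsto_atTop)
      ((continuous_fst.tendsto _).comp hlim) hlp
  refine ⟨fun n => ms n + N, ?_⟩
  rw [((hfg y hy).unique hS hlam (hD hy) hopt).2]
  exact hlp

end Environment

/-! ### Rigidity: a larger loss function that is not more costly is equal -/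

namespace Environment

variable {S : Environment} {lam lam' : ℝ → ℝ}

variable (S) in
/-- At every payment, `lam'` allows a cost that is at most the least cost under `lam`. -/
def CostLE (lam' lam : ℝ → ℝ) : Prop :=
  ∀ y ∈ S.types, ∀ a p, S.AuditFeasible lam y a p →
    ∃ a' p', S.AuditFeasible lam' y a' p' ∧ S.auditCost lam' y a' p' ≤ S.auditCost lam y a p

/-- If two loss functions agree at `z` and the larger one is not more costly, then the smaller one
is not constant above `z`, unless they agree there. -/
theorem CostLE.lt_high (hS : S.Standing) (hlam : S.IsRegularLoss lam)
    (hc : S.CostLE lam' lam) {z x : ℝ} (hz : z ∈ S.types) (heq : lam z = lam' z)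
    (hx : x ∈ S.types) (hzx : z < x) (hlt : lam x < lam' x) : lam z < lam S.xHigh := by
  have hA := hS.isEffortCost_costA
  have hP := hS.isEffortCost_costP
  have hlow : S.xLow < S.xHigh := hS.low_lt_high
  by_contra! hle
  have hz0 : lam z ≤ z := hlam.le_id z hz
  have hI0 : (0 : ℝ) ∈ Icc (0 : ℝ) 1 := left_mem_Icc.2 zero_le_one
  -- If `lam` is constant above `z`, no effort is needed there. Under `lam'` only zero efforts are
  -- as cheap, which bounds `lam'` by its value at `z`.
  have hfeas : S.AuditFeasible lam z 0 0 := by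
    refine ⟨hI0, hI0, fun w hw => ?_, fun w hw => ?_⟩ <;>
    · have := hlam.monotone ⟨hz.1.trans hw.1, hw.2⟩ (right_mem_Icc.2 hlow.le) hw.2
      linarith [hS.rent_zero]
  obtain ⟨a', p', hf, hle'⟩ := hc z hz 0 0 hfeas
  have hmax : max 0 (0 * unitDeriv S.costA 0 - (z - lam z)) = 0 := max_eq_left (by linarith)
  rw [auditCost_eq, auditCost_eq, ← heq, hA.zero, hP.zero, hmax] at hle'
  have h1 := le_max_left (S.costA a') (a' * unitDeriv S.costA a' - (z - lam z))
  have h2 := hA.nonneg hf.agent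
  have h3 := mul_nonneg (sub_nonneg.2 hf.agent.2) (hP.nonneg hf.audit)
  have ha' : a' = 0 := by
    by_contra hne
    linarith [hA.pos hf.agent (lt_of_le_of_ne hf.agent.1 (Ne.symm hne))]
  subst ha'
  have hp' : p' = 0 := by
    by_contra hne
    linarith [hP.pos hf.audit (lt_of_le_of_ne hf.audit.1 (Ne.symm hne))]
  subst hp'
  have h4 := hf.refund x ⟨hzx.le, hx.2⟩
  rw [hS.rent_zero] at h4
  linarith [hlam.monotone hz hx hzx.le]

/-- A larger loss function cannot rise above `lam` right after a type whose loss is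
the full surplus. -/
theorem CostLE.le_right_of_eq_id (hS : S.Standing) (hlam : S.IsRegularLoss lam)
    (hlam' : S.IsRegularLoss lam') (hc : S.CostLE lam' lam) {z : ℝ} (hz : z ∈ S.types)
    (hzz : lam z = z) (hhigh : lam z < lam S.xHigh) :
    ∃ ε > 0, ∀ x ∈ Ioo z (z + ε), lam' x ≤ lam x := by
  have hA := hS.isEffortCost_costA
  have hP := hS.isEffortCost_costP
  have hlow := hS.low_lt_high
  have hHT : S.xHigh ∈ S.types := right_mem_Icc.2 hlow.le
  have hI1 : (1 : ℝ) ∈ Icc (0 : ℝ) 1 := right_mem_Icc.2 zero_le_one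
  have hHid := hlam.le_id _ hHT
  rw [hzz] at hhigh
  have hzH : 0 < S.xHigh - z := by linarith
  -- a lower bound for the agent's effort when audits are not rare
  set σ := (lam S.xHigh - z) / (2 * (S.xHigh - z)) with hσ
  have hσz : σ * (S.xHigh - z) = (lam S.xHigh - z) / 2 := by rw [hσ]; field_simp
  have hσ0 : 0 < σ := div_pos (by linarith) (by linarith)
  have hσ1 : σ ≤ 1 := by
    rw [hσ, div_le_one (by linarith)]
    linarith
  have hσI : σ ∈ Icc (0 : ℝ) 1 := ⟨hσ0.le, hσ1⟩
  have hPσ := hP.pos hσI hσ0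
  have hPσ1 := hP.strictMono.monotoneOn hσI hI1 hσ1
  have hP1 := hS.costP_lt
  obtain ⟨e, he, hev⟩ := hA.exists_unitDeriv_eq (v := S.costP σ / 2) (by linarith) (by linarith)
  have he0 : 0 < e := by
    refine lt_of_le_of_ne he.1 ?_
    rintro rfl
    rw [hA.deriv_zero] at hev
    linarith
  have hP1pos : 0 < S.costP 1 := by linarith
  -- Comparison with the effort `e` shows that, for any audit of at least `σ`, the minimizer of the
  -- refund-free cost is at least `b`.
  set b := e * (S.costP σ / 2) / S.costP 1 with hb
  have hb0 : 0 < b := div_pos (mul_pos he0 (by linarith)) hP1pos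
  have hb1 : b ≤ 1 := by
    rw [hb, div_le_one hP1pos]
    have := mul_le_mul_of_nonneg_right he.2 (by linarith : 0 ≤ S.costP σ / 2)
    linarith
  have hbI : b ∈ Icc (0 : ℝ) 1 := ⟨hb0.le, hb1⟩
  have hρ : 0 < S.rent b := by
    rw [← hS.rent_zero]
    exact hS.rent_strictMonoOn (left_mem_Icc.2 zero_le_one) hbI hb0
  -- The first bound makes the rent cover `y - lam y`, so that no refund is needed; the second keeps
  -- supergradients above `σ`.
  refine ⟨min (S.rent b) ((lam S.xHigh - z) / 2), lt_min hρ (by linarith), ?_⟩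
  rintro x₀ ⟨hzx, hxε⟩
  by_contra! hlt
  have hxρ : x₀ - z ≤ S.rent b := by
    linarith [min_le_left (S.rent b) ((lam S.xHigh - z) / 2)]
  have hxL : x₀ - z < (lam S.xHigh - z) / 2 := by
    linarith [min_le_right (S.rent b) ((lam S.xHigh - z) / 2)]
  have hxH : x₀ < S.xHigh := by linarith
  have hxT : x₀ ∈ S.types := ⟨hz.1.trans hzx.le, hxH.le⟩
  have hxid : lam x₀ < x₀ := hlt.trans_le (hlam'.le_id _ hxT)
  obtain ⟨s, hs⟩ := hlam.exists_supergradient (hz.1.trans_lt hzx) hxH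
  have hs0 : 0 < s := by
    have := hs _ hHT
    by_contra! hneg
    nlinarith
  have hs1 : s < 1 := by
    have := hs _ hz
    by_contra! hneg
    nlinarith
  have hsσ : σ ≤ s := by
    have := hs _ hHT
    refine le_of_mul_le_mul_right ?_ hzH
    nlinarith
  have hsI : s ∈ Icc (0 : ℝ) 1 := ⟨hs0.le, hs1.le⟩
  have hPs := hP.strictMono.monotoneOn hσI hsI hsσ
  have hPs1 := hP.strictMono.monotoneOn hsI hI1 hs1.le
  -- the payment whose audit line with slope `s` is tangent to `lam` at `x₀`
  obtain ⟨y, hyx⟩ : ∃ y, (1 - s) * y = lam x₀ - s * x₀ :=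
    ⟨(lam x₀ - s * x₀) / (1 - s), mul_div_cancel₀ _ (by linarith)⟩
  have hzy : z ≤ y := by
    refine le_of_mul_le_mul_left ?_ (sub_pos.2 hs1)
    linarith [hs _ hz]
  have hyx₀ : y < x₀ := by
    refine lt_of_mul_lt_mul_left ?_ (sub_pos.2 hs1).le
    linarith
  have hyT : y ∈ S.types := ⟨hz.1.trans hzy, hyx₀.le.trans hxH.le⟩
  obtain ⟨a, ha, hmin⟩ := isCompact_Icc.exists_isMinOn (nonempty_Icc.2 zero_le_one)
    (f := fun t : ℝ => t * unitDeriv S.costA t + (1 - t) * S.costP s)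
    ((continuousOn_id.mul hA.continuousOn_unitDeriv).add
      ((continuousOn_const.sub continuousOn_id).mul continuousOn_const))
  have hmin' : ∀ t ∈ Icc (0 : ℝ) 1, a * unitDeriv S.costA a + (1 - a) * S.costP s
      ≤ t * unitDeriv S.costA t + (1 - t) * S.costP s := fun t ht => hmin ht
  have hba : b ≤ a := by
    rw [hb, div_le_iff₀ hP1pos]
    have h1 := hmin' e he
    rw [hev] at h1
    have h2 := mul_nonneg ha.1 (hA.unitDeriv_nonneg ha)
    have h3 := mul_le_mul_of_nonneg_left hPs1 ha.1
    have h4 := mul_le_mul_of_nonneg_left hPs he0.le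
    linarith
  have hrent : y - lam y ≤ S.rent a := by
    have h1 := hS.rent_strictMonoOn.monotoneOn hbI ha hba
    have h2 := hlam.monotone hz hyT hzy
    linarith
  have hfeas : S.AuditFeasible lam y a s := by
    have hseize : ∀ x ∈ Icc y S.xHigh, lam x ≤ s * x + (1 - s) * y := fun x hx => by
      linarith [hs x ⟨hyT.1.trans hx.1, hx.2⟩]
    refine ⟨ha, hsI, hseize, fun x hx => ?_⟩
    have h1 := mul_pos hs0 hS.tau_pos
    have h2 := mul_nonneg hs0.le (hS.low_nonneg.trans hyT.1)
    linarith [hseize x hx]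
  obtain ⟨a', p', hf, hle⟩ := hc y hyT a s hfeas
  unfold auditCost at hle
  rw [min_eq_left (by linarith : y ≤ lam y + S.rent a)] at hle
  have hle2 : a' * unitDeriv S.costA a' + (1 - a') * S.costP p'
      ≤ a * unitDeriv S.costA a + (1 - a) * S.costP s := by
    have := min_le_left y (lam' y + S.rent a')
    have e1 : S.rent a' + S.costA a' = a' * unitDeriv S.costA a' := by unfold rent; ring
    have e2 : S.rent a + S.costA a = a * unitDeriv S.costA a := by unfold rent; ring
    linarith
  have hsp : s < p' := by
    have := hf.seize x₀ ⟨hyx₀.le, hxH.le⟩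
    refine lt_of_mul_lt_mul_right ?_ (sub_pos.2 hyx₀).le
    linarith
  have hPlt := hP.strictMono hsI hf.audit hsp
  -- The audit `p'` exceeds `s`, so an effort below one would undercut the minimum at audit `s`.
  -- Full effort is then excluded by comparison with zero effort.
  have ha' : a' = 1 := by
    by_contra hne
    have h1 := hmin' a' hf.agent
    have h2 := mul_lt_mul_of_pos_left hPlt (sub_pos.2 (lt_of_le_of_ne hf.agent.2 hne))
    linarith
  have h0 := hmin' 0 (left_mem_Icc.2 zero_le_one)
  rw [ha'] at hle2
  linarith

/-- A larger loss function cannot rise above `lam` right after a type whose loss is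
less than the full surplus. -/
theorem CostLE.le_right_of_lt_id (hS : S.Standing) (hlam : S.IsRegularLoss lam)
    (hc : S.CostLE lam' lam) (hle : ∀ x ∈ S.types, lam x ≤ lam' x) {z : ℝ} (hz : z ∈ S.types)
    (heq : ∀ x ∈ S.types, x ≤ z → lam x = lam' x) (hzz : lam z < z)
    (hhigh : lam z < lam S.xHigh) :
    ∃ ε > 0, ∀ x ∈ Ioo z (z + ε), lam' x ≤ lam x := by
  have hlow := hS.low_lt_high
  have hτ := hS.tau_pos
  have hHT : S.xHigh ∈ S.types := right_mem_Icc.2 hlow.le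
  have hLT : S.xLow ∈ S.types := left_mem_Icc.2 hlow.le
  have hsub : Icc S.xLow z ⊆ S.types := Icc_subset_Icc_right hz.2
  choose! f g hfg using fun y (hy : y ∈ S.types) => exists_auditOptimal hS hlam hy
  -- Up to `z` the two functions agree, so efforts feasible under the larger `lam'` are feasible
  -- under `lam` at the same cost. Uniqueness then identifies the optima.
  have hfg' : ∀ y ∈ Icc S.xLow z, S.AuditFeasible lam' y (f y) (g y) := by
    intro y hy
    have hyT := hsub hy
    have hly := heq y hyT hy.2
    obtain ⟨a', p', hf, hcost⟩ := hc y hyT _ _ (hfg y hyT).toAuditFeasible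
    have hopt : S.AuditOptimal lam y a' p' := by
      refine ⟨⟨hf.agent, hf.audit, fun x hx => ?_, fun x hx => ?_⟩, fun a p h => ?_⟩
      · exact (hle x ⟨hyT.1.trans hx.1, hx.2⟩).trans (hf.seize x hx)
      · rw [hly]
        exact (hle x ⟨hyT.1.trans hx.1, hx.2⟩).trans (hf.refund x hx)
      · have h1 := (hfg y hyT).le a p h
        unfold auditCost at hcost h1 ⊢
        rw [← hly] at hcost
        linarith
    obtain ⟨e1, e2⟩ := hopt.unique hS hlam hyT (hfg y hyT)
    rwa [← e1, ← e2]
  -- the last type below `z` whose loss is the full surplus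
  obtain ⟨y₁, ⟨hy₁, hly₁⟩, hlast⟩ : ∃ y₁, IsGreatest {y ∈ Icc S.xLow z | lam y = y} y₁ := by
    refine IsCompact.exists_isGreatest ?_ ⟨S.xLow, ⟨le_rfl, hz.1⟩, hlam.low⟩
    refine isCompact_Icc.of_isClosed_subset ?_ fun y hy => hy.1
    have := ((hlam.continuousOn.mono hsub).sub continuousOn_id).preimage_isClosed_of_isClosed
      isClosed_Icc (isClosed_singleton (x := (0 : ℝ)))
    convert this using 1
    ext y
    simp [sub_eq_zero]
  have hy₁z : y₁ < z := lt_of_le_of_ne hy₁.2 (by rintro rfl; linarith)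
  have hsub₁ : Icc y₁ z ⊆ Icc S.xLow z := Icc_subset_Icc_left hy₁.1
  have hgcont : ContinuousOn g (Icc y₁ z) := by
    refine continuousOn_audit hS hlam (hsub₁.trans hsub) (fun y hy y' hy' hlt => ?_)
      fun y hy => hfg y (hsub (hsub₁ hy))
    refine lt_of_le_of_ne (hlam.le_id y (hsub (hsub₁ hy))) fun e => ?_
    exact absurd (hlast ⟨hsub₁ hy, e⟩) (not_le.2 (hy'.1.trans_lt hlt))
  -- the audit line of `z` is flatter than `lam` just above `z`
  obtain ⟨x₁, hx₁, hflat⟩ : ∃ x₁ > z, ∀ x₀ ∈ Ioo z x₁, ∀ s, 0 ≤ s →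
      (∀ x ∈ S.types, lam x ≤ lam x₀ + s * (x - x₀)) → g z ≤ s := by
    have hopt := hfg z hz
    rcases hopt.audit.1.eq_or_lt with h0 | h0
    · exact ⟨z + 1, by linarith, fun x₀ _ s hs _ => h0 ▸ hs⟩
    obtain ⟨x₁, hx₁, hbind⟩ := hopt.exists_binding hS hlam hz h0
    have hne : z ≠ x₁ := by
      rintro rfl
      have h1 := mul_pos h0 (by linarith [hS.low_add_tau_pos, hz.1] : 0 < z + S.tau)
      have h2 := hS.rent_nonneg hopt.agent
      rcases hbind with h | h <;> linarith
    have hzx₁ := lt_of_le_of_ne hx₁.1 hne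
    refine ⟨x₁, hzx₁, fun x₀ hx₀ s _ hs => ?_⟩
    have hsx := hs x₁ ⟨hz.1.trans hx₁.1, hx₁.2⟩
    refine le_of_mul_le_mul_right ?_ (sub_pos.2 hx₀.2)
    have h1 := hopt.seize x₀ ⟨hx₀.1.le, hx₀.2.le.trans hx₁.2⟩
    have h2 := hopt.refund x₀ ⟨hx₀.1.le, hx₀.2.le.trans hx₁.2⟩
    rcases hbind with h | h <;> linarith
  refine ⟨min (x₁ - z) (lam S.xHigh - lam z), lt_min (by linarith) (by linarith), ?_⟩
  rintro x₀ ⟨hzx, hxε⟩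
  by_contra! hlt
  have hxx₁ : x₀ < x₁ := by linarith [min_le_left (x₁ - z) (lam S.xHigh - lam z)]
  have hxL : x₀ - z < lam S.xHigh - lam z := by
    linarith [min_le_right (x₁ - z) (lam S.xHigh - lam z)]
  have hxH : x₀ < S.xHigh := by linarith [hlam.le_add_sub hz hHT hz.2]
  have hxT : x₀ ∈ S.types := ⟨hz.1.trans hzx.le, hxH.le⟩
  obtain ⟨s, hs⟩ := hlam.exists_supergradient (hz.1.trans_lt hzx) hxH
  have hs0 : 0 < s := by
    have h1 := hs _ hHT
    have h2 := hlam.le_add_sub hz hxT hzx.le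
    by_contra! hneg
    nlinarith
  have hgz := hflat x₀ ⟨hzx, hxx₁⟩ s hs0.le hs
  have hgy₁ : s ≤ g y₁ := by
    have h1 := hs y₁ (hsub hy₁)
    have h2 := (hfg y₁ (hsub hy₁)).seize x₀ ⟨by linarith, hxH.le⟩
    refine le_of_mul_le_mul_right ?_ (sub_pos.2 (hy₁z.trans hzx))
    linarith
  -- A constraint line of slope `s` at this payment touches `lam` somewhere. As `s` is a
  -- supergradient at `x₀`, the line is at most `lam x₀` there, and it also bounds `lam'`.
  obtain ⟨y, hy, hgy⟩ := intermediate_value_Icc' hy₁z.le hgcont ⟨hgz, hgy₁⟩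
  have hyT := hsub (hsub₁ hy)
  obtain ⟨x, hx, hbind⟩ := (hfg y hyT).exists_binding hS hlam hyT (by rw [hgy]; exact hs0)
  have hyx₀ : x₀ ∈ Icc y S.xHigh := ⟨hy.2.trans hzx.le, hxH.le⟩
  have h1 := (hfg' y (hsub₁ hy)).seize x₀ hyx₀
  have h2 := (hfg' y (hsub₁ hy)).refund x₀ hyx₀
  rw [← heq y hyT hy.2] at h2
  have h3 := hs x ⟨hyT.1.trans hx.1, hx.2⟩
  rw [hgy] at h1 h2 hbind
  rcases hbind with h | h <;> linarith

/-- A larger regular loss function that is not more costly at any payment is equal. -/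
theorem CostLE.eqOn (hS : S.Standing) (hlam : S.IsRegularLoss lam)
    (hlam' : S.IsRegularLoss lam') (hc : S.CostLE lam' lam)
    (hle : ∀ x ∈ S.types, lam x ≤ lam' x) : EqOn lam lam' S.types := by
  by_contra hne
  have hlow := hS.low_lt_high
  have hLT : S.xLow ∈ S.types := left_mem_Icc.2 hlow.le
  set B := {x ∈ S.types | lam x < lam' x} with hB
  have hBne : B.Nonempty := by
    by_contra! hemp
    refine hne fun x hx => le_antisymm (hle x hx) ?_
    by_contra! hlt
    exact (hemp ▸ ⟨hx, hlt⟩ : x ∈ (∅ : Set ℝ))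
  have hBbdd : BddBelow B := ⟨S.xLow, fun x hx => hx.1.1⟩
  set z := sInf B with hzdef
  have hzlow : S.xLow ≤ z := le_csInf hBne fun x hx => hx.1.1
  have hzT : z ∈ S.types := by
    obtain ⟨x, hx⟩ := hBne
    exact ⟨hzlow, (csInf_le hBbdd hx).trans hx.1.2⟩
  have hbelow : ∀ x ∈ S.types, x < z → lam x = lam' x := by
    intro x hx hxz
    refine le_antisymm (hle x hx) ?_
    by_contra! hlt
    exact absurd (csInf_le hBbdd ⟨hx, hlt⟩) (not_le.2 hxz)
  have hzeq : lam z = lam' z := by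
    refine le_antisymm (hle z hzT) (le_of_forall_pos_le_add fun ε hε => ?_)
    rcases hzlow.eq_or_lt with e | hlt
    · rw [← e, hlam.low, hlam'.low]
      linarith
    have hxz : max S.xLow (z - ε) < z := max_lt hlt (by linarith)
    have hxT : max S.xLow (z - ε) ∈ S.types := ⟨le_max_left _ _, hxz.le.trans hzT.2⟩
    have h1 := hlam'.le_add_sub hxT hzT hxz.le
    rw [← hbelow _ hxT hxz] at h1
    linarith [hlam.monotone hxT hzT hxz.le, le_max_right S.xLow (z - ε)]
  have heq : ∀ x ∈ S.types, x ≤ z → lam x = lam' x := by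
    intro x hx hxz
    rcases hxz.eq_or_lt with rfl | hlt
    · exact hzeq
    · exact hbelow x hx hlt
  have hfreq : ∀ ε > 0, ∃ x ∈ Ioo z (z + ε), x ∈ B := by
    intro ε hε
    obtain ⟨x, hx, hlt⟩ := exists_lt_of_csInf_lt hBne (show sInf B < z + ε by linarith)
    refine ⟨x, ⟨lt_of_le_of_ne (csInf_le hBbdd hx) fun e => ?_, hlt⟩, hx⟩
    have : x = z := e.symm
    rw [this] at hx
    exact hx.2.ne hzeq
  have hhigh : lam z < lam S.xHigh := by
    obtain ⟨x, hx, hxB⟩ := hfreq 1 one_pos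
    exact hc.lt_high hS hlam hzT hzeq hxB.1 hx.1 hxB.2
  obtain ⟨ε, hε, hno⟩ : ∃ ε > 0, ∀ x ∈ Ioo z (z + ε), lam' x ≤ lam x := by
    rcases (hlam.le_id z hzT).eq_or_lt with e | hlt
    · exact hc.le_right_of_eq_id hS hlam hlam' hzT e hhigh
    · exact hc.le_right_of_lt_id hS hlam hle hzT heq hlt hhigh
  obtain ⟨x, hx, hxB⟩ := hfreq ε hε
  exact absurd hxB.2 (not_lt.2 (hno x hx))

end Environment

/-! ### Mechanisms and their losses -/

namespace Environment

variable {S : Environment} {lam : ℝ → ℝ} {m : ℝ → Contract}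

theorem Standing.types_nonneg (hS : S.Standing) {x : ℝ} (hx : x ∈ S.types) : 0 ≤ x :=
  hS.low_nonneg.trans hx.1

theorem refundNA_nonneg {y : ℝ} {k : Contract} (hk : S.FeasibleAt y k) : 0 ≤ k.refundNA := by
  obtain ⟨-, hp, -, hrP, hrN⟩ := hk
  exact add_nonneg (mul_nonneg hp.1 hrP.1) (mul_nonneg (sub_nonneg.2 hp.2) hrN.1)

theorem loss_le (hS : S.Standing) (hm : ∀ y ∈ S.types, S.FeasibleAt y (m y)) {x y : ℝ}
    (hx : x ∈ S.types) (hy : y ∈ Icc S.xLow x) :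
    S.loss m x ≤ (m y).eP * x + (1 - (m y).eP) * (y - (m y).rN) := by
  refine csInf_le ⟨-S.tau, ?_⟩ (mem_image_of_mem _ hy)
  rintro _ ⟨w, hw, rfl⟩
  obtain ⟨-, hp, -, -, hrN⟩ := hm w ⟨hw.1, hw.2.trans hx.2⟩
  have h1 := mul_nonneg hp.1 (hS.types_nonneg hx)
  have h2 := mul_nonneg (sub_nonneg.2 hp.2) (by linarith [hrN.2] : 0 ≤ w + S.tau - (m w).rN)
  have h3 := mul_nonneg hp.1 hS.tau_pos.le
  simp only
  linarith

theorem le_loss {x v : ℝ} (hx : x ∈ S.types)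
    (h : ∀ y ∈ Icc S.xLow x, v ≤ (m y).eP * x + (1 - (m y).eP) * (y - (m y).rN)) :
    v ≤ S.loss m x := by
  refine le_csInf ((nonempty_Icc.2 hx.1).image _) ?_
  rintro _ ⟨y, hy, rfl⟩
  exact h y hy

theorem loss_le_id (hS : S.Standing) (hm : ∀ y ∈ S.types, S.FeasibleAt y (m y)) {x : ℝ}
    (hx : x ∈ S.types) : S.loss m x ≤ x := by
  have h1 := loss_le hS hm hx (right_mem_Icc.2 hx.1)
  obtain ⟨-, hp, -, -, hrN⟩ := hm x hx
  linarith [mul_nonneg (sub_nonneg.2 hp.2) hrN.1]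

theorem presentProb_mem {e : ℝ} (he : e ∈ Icc (0 : ℝ) 1) (d : Prop) :
    presentProb e d ∈ Icc 0 e := by
  unfold presentProb
  split_ifs
  · exact ⟨he.1, le_rfl⟩
  · exact ⟨le_rfl, he.1⟩

theorem agentPayoff_truthful {x : ℝ} (hx : S.ObedientAt (m x)) :
    S.agentPayoff m x x (m x).eA True = (m x).refundNA + S.rent (m x).eA := by
  unfold ObedientAt at hx
  simp only [agentPayoff, presentProb, if_true, rent, hx]
  ring

/-- The truthful type keeps at least what the audit of any smaller payment would leave. -/
theorem IsMechanism.sub_le_loss (hS : S.Standing) (hm : S.IsMechanism m) {x : ℝ}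
    (hx : x ∈ S.types) : x - (m x).refundNA - S.rent (m x).eA ≤ S.loss m x := by
  refine le_loss hx fun y hy => ?_
  rcases hy.2.eq_or_lt with rfl | hlt
  · obtain ⟨ha, hp, -, hrP, -⟩ := hm.feasible y hx
    have h1 := hS.rent_nonneg ha
    have h2 := mul_nonneg hp.1 hrP.1
    unfold Contract.refundNA
    linarith
  · have h := hm.incentiveCompatible x hx y ⟨hS.low_nonneg.trans hy.1, hy.2⟩ 0
      (left_mem_Icc.2 zero_le_one) False
    rw [agentPayoff_truthful (hm.obedient x hx)] at h
    simp only [agentPayoff, presentProb, auditProb, if_neg hlt.ne, if_neg (not_lt.2 hy.1),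
      if_false, hS.isEffortCost_costA.zero] at h
    linarith

/-- After an underpayment, effort and evidence only hurt, so the loss bound covers all payments of
at least `xLow`; lower payments are audited for sure. After a truthful payment, convexity of the
cost makes the first-order condition sufficient. -/
theorem isMechanism_of_sub_le_loss (hS : S.Standing) (hf : ∀ y ∈ S.types, S.FeasibleAt y (m y))
    (ho : ∀ y ∈ S.types, S.ObedientAt (m y))
    (h : ∀ x ∈ S.types, x - (m x).refundNA - S.rent (m x).eA ≤ S.loss m x) :
    S.IsMechanism m := by
  refine ⟨hf, ho, fun x hx y hy e he d => ?_⟩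
  have hA := hS.isEffortCost_costA
  rw [agentPayoff_truthful (ho x hx)]
  have hR := refundNA_nonneg (hf x hx)
  have ha := (hf x hx).1
  have hu := hS.rent_nonneg ha
  have hq := presentProb_mem he d
  have hce := hA.nonneg he
  unfold agentPayoff
  split_ifs with hyx
  · have h1 : unitDeriv S.costA (m x).eA = (m x).rA - (m x).refundNA := ho x hx
    have h2 := hA.tangent_le ha he
    have h3 := mul_le_mul_of_nonneg_right hq.2 (hA.unitDeriv_nonneg ha)
    have h4 : presentProb e d * unitDeriv S.costA (m x).eA
        = presentProb e d * (m x).rA - presentProb e d * (m x).refundNA := by rw [h1]; ring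
    unfold rent
    linarith
  · rcases lt_or_ge y S.xLow with hlow | hlow
    · simp only [auditProb, if_pos hlow]
      linarith
    · simp only [auditProb, if_neg (not_lt.2 hlow)]
      obtain ⟨-, hp, -, -, hrN⟩ := hf y ⟨hlow, hy.2.trans hx.2⟩
      have h1 := mul_nonneg (sub_nonneg.2 hp.2) (by linarith [hy.2, hrN.1] :
        0 ≤ x - (y - (m y).rN))
      have h2 := mul_nonneg hq.1 h1
      linarith [h x hx, loss_le hS hf hx ⟨hlow, hy.2⟩]

theorem Solves.le_loss (hm : S.Solves lam m) {x : ℝ} (hx : x ∈ S.types) :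
    lam x ≤ S.loss m x :=
  Environment.le_loss hx fun y hy => (hm y ⟨hy.1, hy.2.trans hx.2⟩).1.2.2.1 x ⟨hy.2, hx.2⟩

theorem Solves.isMechanism (hS : S.Standing) (hm : S.Solves lam m) : S.IsMechanism m :=
  isMechanism_of_sub_le_loss hS (fun y hy => (hm y hy).1.1) (fun y hy => (hm y hy).1.2.2.2)
    fun _ hx => (hm _ hx).1.2.1.trans (hm.le_loss hx)

/-! ### The tightening algorithm and tight mechanisms -/

theorem loss_le_lossPlus (hS : S.Standing) (hm : S.IsMechanism m) {y z : ℝ} (hy : y ∈ S.types)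
    (hz : z ∈ Icc S.xLow y) : S.loss m z ≤ S.lossPlus m y := by
  refine le_max_of_le_right (le_csSup ⟨y, ?_⟩ (mem_image_of_mem _ hz))
  rintro _ ⟨w, hw, rfl⟩
  exact (loss_le_id hS hm.feasible ⟨hw.1, hw.2.trans hy.2⟩).trans hw.2

theorem le_lossTilde (hS : S.Standing) {x v : ℝ}
    (h : ∀ y ∈ S.types, v ≤ (m y).eP * x +
      min ((1 - (m y).eP) * y) (S.lossPlus m y + S.rent (m y).eA + (m y).eP * S.tau)) :
    v ≤ S.lossTilde m x := by
  refine le_csInf ((nonempty_Icc.2 hS.low_lt_high.le).image _) ?_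
  rintro _ ⟨y, hy, rfl⟩
  exact h y hy

theorem lossTilde_le (hS : S.Standing) (hm : S.IsMechanism m) {x y : ℝ} (hx : x ∈ S.types)
    (hy : y ∈ S.types) : S.lossTilde m x ≤ (m y).eP * x +
      min ((1 - (m y).eP) * y) (S.lossPlus m y + S.rent (m y).eA + (m y).eP * S.tau) := by
  refine csInf_le ⟨0, ?_⟩ (mem_image_of_mem _ hy)
  rintro _ ⟨w, hw, rfl⟩
  obtain ⟨ha, hp, -⟩ := hm.feasible w hw
  refine add_nonneg (mul_nonneg hp.1 (hS.types_nonneg hx))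
    (le_min (mul_nonneg (sub_nonneg.2 hp.2) (hS.types_nonneg hw)) ?_)
  exact add_nonneg (add_nonneg (hS.low_nonneg.trans (le_max_left _ _)) (hS.rent_nonneg ha))
    (mul_nonneg hp.1 hS.tau_pos.le)

/-- An infimum of affine functions with nonnegative slopes is increasing and concave. Every line is
at least `xLow` at `xLow`, and the line of payment `x` is at most `x` at `x`. -/
theorem IsMechanism.isRegularLoss_lossTilde (hS : S.Standing) (hm : S.IsMechanism m) :
    S.IsRegularLoss (S.lossTilde m) := by
  have hle : ∀ x ∈ S.types, S.lossTilde m x ≤ x := fun x hx => by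
    have h1 := lossTilde_le hS hm hx hx
    have h2 := min_le_left ((1 - (m x).eP) * x)
      (S.lossPlus m x + S.rent (m x).eA + (m x).eP * S.tau)
    linarith
  have hlow : S.xLow ∈ S.types := left_mem_Icc.2 hS.low_lt_high.le
  refine ⟨fun x hx x' hx' hxx' => ?_, ⟨convex_Icc _ _, fun x hx x' hx' s t hs ht hst => ?_⟩,
    le_antisymm (hle _ hlow) ?_, hle⟩
  · refine le_lossTilde hS fun y hy => (lossTilde_le hS hm hx hy).trans ?_
    gcongr
    exact (hm.feasible y hy).2.1.1
  · refine le_lossTilde hS fun y hy => ?_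
    have h1 := mul_le_mul_of_nonneg_left (lossTilde_le hS hm hx hy) hs
    have h2 := mul_le_mul_of_nonneg_left (lossTilde_le hS hm hx' hy) ht
    simp only [smul_eq_mul]
    refine (add_le_add h1 h2).trans_eq ?_
    obtain rfl : t = 1 - s := by linarith
    ring
  · refine le_lossTilde hS fun y hy => ?_
    obtain ⟨ha, hp, -⟩ := hm.feasible y hy
    have h1 : S.xLow ≤ S.lossPlus m y := le_max_left _ _
    have h2 := hS.rent_nonneg ha
    have h3 := mul_nonneg hp.1 hS.tau_pos.le
    have h4 := mul_nonneg hp.1 hS.low_nonneg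
    have h5 := mul_le_mul_of_nonneg_left hy.1 (sub_nonneg.2 hp.2)
    have : S.xLow - (m y).eP * S.xLow ≤ min ((1 - (m y).eP) * y)
      (S.lossPlus m y + S.rent (m y).eA + (m y).eP * S.tau) :=
      le_min (by linarith) (by linarith)
    linarith

/-- Lines of payments `y ≤ x` relax the terms defining the loss, by the refund bounds and incentive
compatibility at `y`. For `y` above `x`, the bound `loss ≤ id` and the running supremum `lossPlus`
take over. -/
theorem IsMechanism.loss_le_lossTilde (hS : S.Standing) (hm : S.IsMechanism m) {x : ℝ}
    (hx : x ∈ S.types) : S.loss m x ≤ S.lossTilde m x := by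
  refine le_lossTilde hS fun y hy => ?_
  obtain ⟨ha, hp, -, hrP, hrN⟩ := hm.feasible y hy
  have hu := hS.rent_nonneg ha
  have hpx := mul_nonneg hp.1 (hS.types_nonneg hx)
  have hpτ := mul_nonneg hp.1 hS.tau_pos.le
  rw [← min_add_add_left]
  rcases le_total y x with hyx | hxy
  · have h1 := loss_le hS hm.feasible hx ⟨hy.1, hyx⟩
    have h2 := mul_nonneg (sub_nonneg.2 hp.2) hrN.1
    have h3 := mul_le_mul_of_nonneg_left hrP.2 hp.1
    have h4 := hm.sub_le_loss hS hy
    have h5 := loss_le_lossPlus hS hm hy (right_mem_Icc.2 hy.1)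
    unfold Contract.refundNA at h4
    exact le_min (by linarith) (by linarith)
  · have h1 := loss_le_id hS hm.feasible hx
    have h2 := mul_nonneg (sub_nonneg.2 hp.2) (sub_nonneg.2 hxy)
    have h3 := loss_le_lossPlus hS hm hy ⟨hx.1, hxy⟩
    exact le_min (by linarith) (by linarith)

theorem IsMechanism.lossPlus_le_lossTilde (hS : S.Standing) (hm : S.IsMechanism m) {y : ℝ}
    (hy : y ∈ S.types) : S.lossPlus m y ≤ S.lossTilde m y := by
  have hreg := hm.isRegularLoss_lossTilde hS
  refine max_le (hreg.low_le hy) (csSup_le ((nonempty_Icc.2 hy.1).image _) ?_)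
  rintro _ ⟨z, hz, rfl⟩
  have hzT : z ∈ S.types := ⟨hz.1, hz.2.trans hy.2⟩
  exact (hm.loss_le_lossTilde hS hzT).trans (hreg.monotone hzT hy hz.2)

/-- The efforts of a mechanism remain feasible under its regularized loss function. -/
theorem IsMechanism.auditFeasible_lossTilde (hS : S.Standing) (hm : S.IsMechanism m) {y : ℝ}
    (hy : y ∈ S.types) : S.AuditFeasible (S.lossTilde m) y (m y).eA (m y).eP := by
  obtain ⟨ha, hp, -⟩ := hm.feasible y hy
  refine ⟨ha, hp, fun x hx => ?_, fun x hx => ?_⟩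
  · have h1 := lossTilde_le hS hm (⟨hy.1.trans hx.1, hx.2⟩ : x ∈ S.types) hy
    have h2 := min_le_left ((1 - (m y).eP) * y)
      (S.lossPlus m y + S.rent (m y).eA + (m y).eP * S.tau)
    linarith
  · have h1 := lossTilde_le hS hm (⟨hy.1.trans hx.1, hx.2⟩ : x ∈ S.types) hy
    have h2 := min_le_right ((1 - (m y).eP) * y)
      (S.lossPlus m y + S.rent (m y).eA + (m y).eP * S.tau)
    linarith [hm.lossPlus_le_lossTilde hS hy]

theorem IsMechanism.profit_le (hS : S.Standing) (hm : S.IsMechanism m) {y : ℝ}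
    (hy : y ∈ S.types) :
    S.profit m y ≤ - S.auditCost (S.lossTilde m) y (m y).eA (m y).eP := by
  have h1 := hm.sub_le_loss hS hy
  have h2 := hm.loss_le_lossTilde hS hy
  have h3 := refundNA_nonneg (hm.feasible y hy)
  have h4 : y - (m y).refundNA ≤ min y (S.lossTilde m y + S.rent (m y).eA) :=
    le_min (by linarith) (by linarith)
  unfold profit profitAt auditCost
  linarith

/-- A solution for `lam` is only improved upon by mechanisms whose regularized loss is `lam`. -/
theorem Solves.eqOn_lossTilde (hS : S.Standing) (hlam : S.IsRegularLoss lam)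
    (hm : S.Solves lam m) {m' : ℝ → Contract} (hm' : S.IsMechanism m')
    (hloss : ∀ x ∈ S.types, lam x ≤ S.loss m' x)
    (hprofit : ∀ x ∈ S.types, S.profit m x ≤ S.profit m' x) :
    EqOn lam (S.lossTilde m') S.types := by
  refine CostLE.eqOn hS hlam (hm'.isRegularLoss_lossTilde hS) (fun y hy a p h => ?_)
    fun x hx => (hloss x hx).trans (hm'.loss_le_lossTilde hS hx)
  refine ⟨_, _, hm'.auditFeasible_lossTilde hS hy, ?_⟩
  have h1 : - S.auditCost lam y a p ≤ S.profit m y :=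
    neg_auditCost_le_profitAt hS hlam hy (hm y hy) h
  linarith [hm'.profit_le hS hy, hprofit y hy]

/-- A solution trivially improves upon itself, so the loss is squeezed between `lam` and the
regularized loss, which coincide. -/
theorem Solves.eqOn_loss (hS : S.Standing) (hlam : S.IsRegularLoss lam) (hm : S.Solves lam m) :
    EqOn lam (S.loss m) S.types := by
  have hmech := hm.isMechanism hS
  have h := hm.eqOn_lossTilde hS hlam hmech (fun x hx => hm.le_loss hx) fun _ _ => le_rfl
  intro x hx
  exact le_antisymm (hm.le_loss hx) ((hmech.loss_le_lossTilde hS hx).trans_eq (h hx).symm)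

theorem IsMechanism.mem_constraintSet (hS : S.Standing) (hm : S.IsMechanism m)
    (h : EqOn lam (S.loss m) S.types) {y : ℝ} (hy : y ∈ S.types) :
    m y ∈ S.constraintSet lam y := by
  refine ⟨hm.feasible y hy, ?_, fun x hx => ?_, hm.obedient y hy⟩
  · rw [h hy]
    exact hm.sub_le_loss hS hy
  · have hxT : x ∈ S.types := ⟨hy.1.trans hx.1, hx.2⟩
    rw [h hxT]
    exact loss_le hS hm.feasible hxT ⟨hy.1, hx.1⟩

/-- A tighter mechanism also has loss `lam`, so its contracts satisfy the constraints for `lam` and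
cannot earn more than the maximizers. -/
theorem Solves.isTight (hS : S.Standing) (hlam : S.IsRegularLoss lam) (hm : S.Solves lam m) :
    S.IsTight m := by
  refine ⟨hm.isMechanism hS, fun m' hm' ht => ?_⟩
  have heq := hm.eqOn_loss hS hlam
  have hle : ∀ x ∈ S.types, lam x ≤ S.loss m' x := fun x hx =>
    (heq hx).trans_le (ht x hx).2
  have htilde := hm.eqOn_lossTilde hS hlam hm' hle fun x hx => (ht x hx).1
  have heq' : EqOn lam (S.loss m') S.types := fun x hx =>
    le_antisymm (hle x hx) ((hm'.loss_le_lossTilde hS hx).trans_eq (htilde hx).symm)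
  exact ⟨fun x hx => le_antisymm (ht x hx).1
    ((hm x hx).2 _ (hm'.mem_constraintSet hS heq' hx)), heq.symm.trans heq'⟩

theorem exists_solves (hS : S.Standing) (hlam : S.IsRegularLoss lam) :
    ∃ m : ℝ → Contract, S.Solves lam m := by
  have : ∀ y, ∃ k, y ∈ S.types → k ∈ S.solutionSet lam y := fun y => by
    by_cases hy : y ∈ S.types
    · obtain ⟨k, hk⟩ := solutionSet_nonempty hS hlam hy
      exact ⟨k, fun _ => hk⟩
    · exact ⟨⟨0, 0, 0, 0, 0⟩, fun h => absurd h hy⟩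
  choose m hm using this
  exact ⟨m, fun y hy => hm y hy⟩

theorem IsTighteningOutput.tighter (hS : S.Standing) (hm : S.IsMechanism m) {mStar : ℝ → Contract}
    (h : S.IsTighteningOutput m mStar) : S.Tighter mStar m := by
  have hreg := hm.isRegularLoss_lossTilde hS
  intro x hx
  refine ⟨(hm.profit_le hS hx).trans ?_, (hm.loss_le_lossTilde hS hx).trans (Solves.le_loss h hx)⟩
  exact neg_auditCost_le_profitAt hS hreg hx (h x hx) (hm.auditFeasible_lossTilde hS hx)

/-- An output of the algorithm is tighter, so by tightness it has the same profit and loss. Its loss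
is the regularized one, hence the given contracts are feasible and attain the maximum. -/
theorem IsTight.solves_lossTilde (hS : S.Standing) (hm : S.IsTight m) :
    S.Solves (S.lossTilde m) m := by
  have hreg := hm.1.isRegularLoss_lossTilde hS
  obtain ⟨mStar, hStar⟩ := exists_solves hS hreg
  obtain ⟨hprofit, hloss⟩ := hm.2 mStar (hStar.isMechanism hS)
    (IsTighteningOutput.tighter hS hm.1 hStar)
  have heq : EqOn (S.lossTilde m) (S.loss m) S.types :=
    (hStar.eqOn_loss hS hreg).trans hloss.symm
  exact fun y hy => ⟨hm.1.mem_constraintSet hS heq hy, fun k hk =>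
    ((hStar y hy).2 k hk).trans_eq (hprofit hy).symm⟩

end Environment

theorem mainTheorem5 (S : Environment) (hS : S.Standing) :
    (∀ m : ℝ → Contract,
      S.IsTight m ↔ ∃ lam : ℝ → ℝ, S.IsRegularLoss lam ∧ S.Solves lam m) ∧
    (∀ (m : ℝ → Contract) (lam : ℝ → ℝ), S.IsRegularLoss lam → S.Solves lam m →
      EqOn lam (S.loss m) S.types) ∧
    (∀ m : ℝ → Contract, S.IsMechanism m →
      (∃ mStar : ℝ → Contract, S.IsTighteningOutput m mStar) ∧
      ∀ mStar : ℝ → Contract, S.IsTighteningOutput m mStar →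
        S.IsTight mStar ∧ S.Tighter mStar m) := by
  refine ⟨fun m => ⟨fun hm => ?_, fun ⟨lam, hlam, hm⟩ => hm.isTight hS hlam⟩,
    fun m lam hlam hm => hm.eqOn_loss hS hlam, fun m hm => ⟨?_, fun mStar hStar => ?_⟩⟩
  · exact ⟨_, hm.1.isRegularLoss_lossTilde hS, hm.solves_lossTilde hS⟩
  · exact Environment.exists_solves hS (hm.isRegularLoss_lossTilde hS)
  · exact ⟨Environment.Solves.isTight hS (hm.isRegularLoss_lossTilde hS) hStar, hStar.tighter hS hm⟩
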